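/- **Setting.** Fix sets of threads, pointer variables $\mathit{PVar}$, data variables $\mathit{DVar}$, function names, an infinite set $\mathit{Adr}$ of addresses, and a data domain $\mathit{Dom}$ with an element $0$ and a relation $<$; let $\mathtt{seg}\notin\mathit{Adr}$. Pointer expressions are pointer variables and selectors $a.\mathtt{next}$; data expressions are data variables and selectors $a.\mathtt{data}$ ($a\in\mathit{Adr}$). A *memory* is a partial function $m$ from pointer expressions to $\mathit{Adr}\cup\{\mathtt{seg}\}$ and from data expressions to $\mathit{Dom}$; $\bot$ means undefined. For a set $P$ of pointer expressions, $m(P)=\{m(e):e\in P\}\cap\mathit{Adr}$, and $m|_P$ is the restriction of $m$ to $P\cup\mathit{DVar}\cup\{a.\mathtt{data}:a\in m(P)\}$. Let $\mathrm{adr}(m)$ be the set of $a\in\mathit{Adr}$ that are in the range of $m$ or have a selector in the domain of $m$. *Commands* are $p:=q$, $p.\mathtt{next}:=q$, $p:=q.\mathtt{next}$, $x:=op(y_1,\dots,y_n)$, $p.\mathtt{data}:=y$, $x:=q.\mathtt{data}$, $\mathtt{assert}\,c$ with $c$ of the form $p=q$, $p\ne q$, $x=y$, $x\ne y$ or $x<y$,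 $p:=\mathtt{malloc}$, $\mathtt{enter}\,f(\vec p,\vec x)$ and $\mathtt{exit}$. A *data structure* $D$ gives each thread an initial control location and a partial function which maps a location and a command to the next location. A *computation* $\tau$ is a finite sequence of actions $(t,com,up)$ with a thread $t$, a command or an environment action $\mathtt{free}(a)$, and a memory update $up$. Let $m_\tau$ be the memory after $\tau$ (initially $p\mapsto\mathtt{seg}$, $x\mapsto 0$, selectors undefined), and $\mathrm{ctrl}(\tau)$ the control locations of all threads (frees do not change them). $\mathrm{fresh}_\tau$ are the addresses never allocated or freed in $\tau$, $\mathrm{freed}_\tau$ those freed since their last allocation. The *history* $H(\tau)$ is the sequence of events $f(t,m_\tau(\vec p),m_\tau(\vec x))$, $\mathtt{exit}(t)$, $\mathtt{free}(a)$ emitted by its $\mathtt{enter}$, $\mathtt{exit}$ and $\mathtt{free}$ actions, arguments being evaluated when the action is executed. An *observer* $\mathcal O$ is an automaton over events, with guards that are Boolean combinations of equalities of event parameters and observer variables; the valuation of the variables is chosen initially and never changes. $\mathcal S(\mathcal O)$ is the set of histories that lead no initial state to an accepting state. Put $\mathcal F(h,a)=\{h' : hh'\in\mathcal S(\mathcal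 O)$ and every $\mathtt{free}(b)$ in $h'$ has $b=a\}$, and $\mathcal F(\tau,a)=\mathcal F(H(\tau),a)$. For $X\subseteq\mathit{Adr}$ let $[\![D]\!]_X$ be the least set of computations that contains $\varepsilon$ and, with $\tau$, each $\tau.(t,com,up)$ such that either $com=\mathtt{free}(a)$, $H(\tau).\mathtt{free}(a)\in\mathcal S(\mathcal O)$ and $up=[a.\mathtt{next}\mapsto\bot,a.\mathtt{data}\mapsto\bot]$; or $com$ is allowed by the control of $t$ and has its usual effect $up$, where $p:=\mathtt{malloc}$ has $up=[p\mapsto a,a.\mathtt{next}\mapsto\mathtt{seg},a.\mathtt{data}\mapsto d]$ for some $d\in\mathit{Dom}$ and $a\in\mathrm{fresh}_\tau\cup(\mathrm{freed}_\tau\cap X)$, accesses through $p.\mathtt{next}$ or $p.\mathtt{data}$ require $m_\tau(p)\in\mathit{Adr}$, assertions require their condition, $\mathtt{enter}\,f(\vec p,\vec x)$ requires $m_\tau(p_i)\in\mathit{Adr}$ for all $i$, and the data arguments of operations and calls must be defined. *Valid* pointer expressions $V_\tau$: $V_\varepsilon=\mathit{PVar}$; an assignment ($p:=q$, $p.\mathtt{next}:=q$,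 $p:=q.\mathtt{next}$) makes its target (with $p.\mathtt{next}$, $q.\mathtt{next}$ standing for $m_\tau(p).\mathtt{next}$, $m_\tau(q).\mathtt{next}$) valid if its source is valid and invalid otherwise; $\mathtt{free}(a)$ makes $a.\mathtt{next}$ and all pointer expressions with value $a$ invalid; $p:=\mathtt{malloc}$ returning $a$ makes $p$ and $a.\mathtt{next}$ valid; $\mathtt{assert}\,p=q$ makes $p,q$ valid if one of them is valid; nothing else changes validity. The valid addresses are $\mathrm{adr}(m_\tau|_{V_\tau})$. **Relations.** - $\tau\sim\sigma$: $\mathrm{ctrl}(\tau)=\mathrm{ctrl}(\sigma)$ and $m_\tau|_{V_\tau}=m_\sigma|_{V_\sigma}$. - $\tau\sqsubseteq\sigma$: $\mathcal F(\tau,a)\subseteq\mathcal F(\sigma,a)$ for every valid address $a$ of $\tau$. - $\tau\equiv_a\sigma$: $m_\tau(p)=a\Leftrightarrow m_\sigma(p)=a$ for all $p\in\mathit{PVar}$; $m_\tau(b.\mathtt{next})=a\Leftrightarrow m_\sigma(b.\mathtt{next})=a$ for all $b\in m_\tau(V_\tau)$; $a\in\mathrm{fresh}_\tau\cup\mathrm{freed}_\tau\Leftrightarrow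 a\in\mathrm{fresh}_\sigma\cup\mathrm{freed}_\sigma$; and $\mathcal F(\tau,a)\subseteq\mathcal F(\sigma,a)$. **Assumptions.** 1. *Pointer race freedom.* For no $a$ does $[\![D]\!]_{\{a\}}$ contain a computation $\tau.act$ in which $act$ accesses $p.\mathtt{next}$ or $p.\mathtt{data}$ with $p\notin V_\tau$, or in which $act=(t,\mathtt{enter}\,f(\vec p,\vec x),\emptyset)$ is racy: with $h=H(\tau)$, $\vec a=m_\tau(\vec p)$, $\vec d=m_\tau(\vec x)$, there are $c\in\mathit{Adr}$ and $\vec b\in\mathit{Adr}^{|\vec a|}$ such that $a_i=b_i$ whenever $a_i=c$ or $p_i\in V_\tau$, and $\mathcal F(h.f(t,\vec b,\vec d),c)\not\subseteq\mathcal F(h.f(t,\vec a,\vec d),c)$. 2. *No harmful ABAs.* For all addresses $a,b$, all $\sigma_a.act\in[\![D]\!]_{\{a\}}$ with $act$ an assertion, and all $\sigma_b\in[\![D]\!]_{\{b\}}$ with $\sigma_a\sim\sigma_b$, there is $\sigma_b'\in[\![D]\!]_{\{b\}}$ with $\sigma_a.act\sim\sigma_b'$, $\sigma_b\equiv_b\sigma_b'$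 and $\sigma_a.act\sqsubseteq\sigma_b'$. 3. *Elision support.* (i) If $a\ne c\ne b$ and $h_2$ arises from $h_1$ by swapping $a$ and $b$ in all events, then $\mathcal F(h_1,c)=\mathcal F(h_2,c)$. (ii) If $\mathcal F(h_1,a)\subseteq\mathcal F(h_2,a)$, $b$ does not occur in $h_2$, and $b$ does not occur in $h_1$ or its last occurrence in $h_1$ is in a $\mathtt{free}(b)$, then $\mathcal F(h_1,b)\subseteq\mathcal F(h_2,b)$. (iii) If $a\ne b$ and $h.\mathtt{free}(a)\in\mathcal S(\mathcal O)$, then $\mathcal F(h.\mathtt{free}(a),b)=\mathcal F(h,b)$. **Lemma.** Under these assumptions, for every $\tau\in[\![D]\!]_{\mathit{Adr}}$ and every $a\in\mathit{Adr}$ there is $\sigma\in[\![D]\!]_{\{a\}}$ with $\tau\sim\sigma$, $\tau\sqsubseteq\sigma$ and $\tau\equiv_a\sigma$. -/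

import Mathlib

namespace SMR

/-! ### Memory -/

/-- Values of pointer expressions: the undefined pointer `seg`, or an address. -/
inductive PVal (Adr : Type*) where
  | seg
  | adr (a : Adr)

/-- Pointer expressions: pointer variables and the pointer selectors `a.next`. -/
inductive PExp (PVar Adr : Type*) where
  | var (p : PVar)
  | sel (a : Adr)

/-- Data expressions: data variables and the data selectors `a.data`. -/
inductive DExp (DVar Adr : Type*) where
  | var (x : DVar)
  | sel (a : Adr)

/-- A memory is a partial function; `none` plays the role of `⊥`. -/
@[ext]
structure Memory (PVar DVar Adr Dom : Type*) where
  ptr : PExp PVar Adr → Option (PVal Adr)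
  dat : DExp DVar Adr → Option Dom

/-- A single update `e ↦ v`, where `v` may be `⊥`. -/
inductive Upd (PVar DVar Adr Dom : Type*) where
  | ptr (e : PExp PVar Adr) (v : Option (PVal Adr))
  | dat (e : DExp DVar Adr) (v : Option Dom)

namespace Memory

variable {PVar DVar Adr Dom : Type*}

/-- Initially pointer variables are `seg`, data variables are `0`, selectors are `⊥`. -/
def initial [Zero Dom] : Memory PVar DVar Adr Dom where
  ptr e := match e with
    | .var _ => some .seg
    | .sel _ => none
  dat e := match e with
    | .var _ => some 0
    | .sel _ => none

open Classical in
/-- `m[e ↦ v]`. -/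
noncomputable def set (m : Memory PVar DVar Adr Dom) :
    Upd PVar DVar Adr Dom → Memory PVar DVar Adr Dom
  | .ptr e v => { m with ptr := Function.update m.ptr e v }
  | .dat e v => { m with dat := Function.update m.dat e v }

/-- `m[up]`. -/
noncomputable def apply (m : Memory PVar DVar Adr Dom) (up : List (Upd PVar DVar Adr Dom)) :
    Memory PVar DVar Adr Dom :=
  up.foldl set m

/-- The addresses in the lifted image `m(P)` of a set of pointer expressions. -/
def image (m : Memory PVar DVar Adr Dom) (P : Set (PExp PVar Adr)) : Set Adr :=
  {a | ∃ e ∈ P, m.ptr e = some (.adr a)}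

open Classical in
/-- The restriction `m|_P`, with domain `P ∪ DVar ∪ {a.data | a ∈ m(P)}`. -/
noncomputable def restrict (m : Memory PVar DVar Adr Dom) (P : Set (PExp PVar Adr)) :
    Memory PVar DVar Adr Dom where
  ptr e := if e ∈ P then m.ptr e else none
  dat e := match e with
    | .var x => m.dat (.var x)
    | .sel a => if a ∈ m.image P then m.dat (.sel a) else none

/-- The in-use addresses: those in the range of `m`, and those with a selector in its domain. -/
def adrs (m : Memory PVar DVar Adr Dom) : Set Adr :=
  {a | (∃ e, m.ptr e = some (.adr a)) ∨ m.ptr (.sel a) ≠ none ∨ m.dat (.sel a) ≠ none}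

/-- The address held by a pointer variable, if any. -/
def adrOf (m : Memory PVar DVar Adr Dom) (p : PVar) : Option Adr :=
  match m.ptr (.var p) with
  | some (.adr a) => some a
  | _ => none

end Memory

/-! ### Commands, actions, computations -/

/-- Conditions of assertions. -/
inductive Cond (PVar DVar : Type*) where
  | peq (p q : PVar)
  | pne (p q : PVar)
  | deq (x y : DVar)
  | dne (x y : DVar)
  | dlt (x y : DVar)

/-- The truth value of a condition in a memory. -/
def Cond.Holds {PVar DVar Adr Dom : Type*} [LT Dom] (m : Memory PVar DVar Adr Dom) :
    Cond PVar DVar → Prop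
  | .peq p q => m.ptr (.var p) = m.ptr (.var q)
  | .pne p q => m.ptr (.var p) ≠ m.ptr (.var q)
  | .deq x y => m.dat (.var x) = m.dat (.var y)
  | .dne x y => m.dat (.var x) ≠ m.dat (.var y)
  | .dlt x y => ∃ c d, m.dat (.var x) = some c ∧ m.dat (.var y) = some d ∧ c < d

/-- Atomic commands of the data structure. -/
inductive Com (PVar DVar Dom Func : Type*) where
  /-- `p := q` -/
  | assign (p q : PVar)
  /-- `p.next := q` -/
  | store (p q : PVar)
  /-- `p := q.next` -/
  | load (p q : PVar)
  /-- `x := op(y₁, …, yₙ)` -/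
  | op (x : DVar) (f : List Dom → Dom) (ys : List DVar)
  /-- `p.data := y` -/
  | storeData (p : PVar) (y : DVar)
  /-- `x := q.data` -/
  | loadData (x : DVar) (q : PVar)
  /-- `assert cond` -/
  | assert (c : Cond PVar DVar)
  /-- `p := malloc` -/
  | malloc (p : PVar)
  /-- `enter func(p₁, …, pₙ, x₁, …, xₘ)` -/
  | enter (f : Func) (ps : List PVar) (xs : List DVar)
  /-- `exit` -/
  | exit

/-- The command component of an action: a command of the data structure, or an environment
`free(a)`. -/
inductive Cmd (PVar DVar Adr Dom Func : Type*) where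
  | prog (c : Com PVar DVar Dom Func)
  | free (a : Adr)

/-- Actions `(t, com, up)`. -/
structure Action (Thread PVar DVar Adr Dom Func : Type*) where
  thread : Thread
  cmd : Cmd PVar DVar Adr Dom Func
  up : List (Upd PVar DVar Adr Dom)

/-- Sequences of actions, growing to the right: `ε` and `τ.act`. -/
inductive Comp (Thread PVar DVar Adr Dom Func : Type*) where
  | nil
  | snoc (τ : Comp Thread PVar DVar Adr Dom Func) (act : Action Thread PVar DVar Adr Dom Func)

/-- Events of histories: `func(t, a₁, …, aₙ, d₁, …, dₘ)`, `exit(t)`, `free(a)`. -/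
inductive Event (Thread Adr Dom Func : Type*) where
  | call (f : Func) (t : Thread) (as : List Adr) (ds : List Dom)
  | exit (t : Thread)
  | free (a : Adr)

/-! ### Observers -/

/-- Event types. -/
inductive EvKind (Func : Type*) where
  | call (f : Func)
  | exit
  | free

/-- Values of event parameters and observer variables. -/
inductive Value (Thread Adr Dom : Type*) where
  | thr (t : Thread)
  | adr (a : Adr)
  | dat (d : Dom)

/-- Terms in guards: observer variables and the formal parameters of the event. -/
inductive Term (OVar : Type*) where
  | var (v : OVar)
  | thread
  | adrArg (i : ℕ)
  | datArg (i : ℕ)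

/-- Guards: Boolean formulas over equalities of observer variables and event parameters. -/
inductive Guard (OVar : Type*) where
  | tru
  | eq (x y : Term OVar)
  | neg (g : Guard OVar)
  | conj (g g' : Guard OVar)
  | disj (g g' : Guard OVar)

namespace Event

variable {Thread Adr Dom Func : Type*}

def kind : Event Thread Adr Dom Func → EvKind Func
  | call f _ _ _ => .call f
  | exit _ => .exit
  | free _ => .free

/-- The addresses occurring in an event. -/
def adrs : Event Thread Adr Dom Func → List Adr
  | call _ _ as _ => as
  | exit _ => []
  | free a => [a]

/-- The data values occurring in an event. -/
def dats : Event Thread Adr Dom Func → List Dom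
  | call _ _ _ ds => ds
  | exit _ => []
  | free _ => []

def thread : Event Thread Adr Dom Func → Option Thread
  | call _ t _ _ => some t
  | exit t => some t
  | free _ => none

open Classical in
/-- Replace `a` by `b`, and vice versa, in an event. -/
noncomputable def rename (a b : Adr) : Event Thread Adr Dom Func → Event Thread Adr Dom Func
  | call f t as ds => call f t (as.map (Equiv.swap a b)) ds
  | exit t => exit t
  | free c => free (Equiv.swap a b c)

end Event

/-- The value of a term, given the observer variables and the actual event (`none` if the event
has no such parameter). -/
def Term.eval {Thread Adr Dom Func OVar : Type*} (φ : OVar → Value Thread Adr Dom)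
    (e : Event Thread Adr Dom Func) : Term OVar → Option (Value Thread Adr Dom)
  | .var v => some (φ v)
  | .thread => e.thread.map .thr
  | .adrArg i => e.adrs[i]?.map .adr
  | .datArg i => e.dats[i]?.map .dat

/-- Satisfaction of a guard. -/
def Guard.Sat {Thread Adr Dom Func OVar : Type*} (φ : OVar → Value Thread Adr Dom)
    (e : Event Thread Adr Dom Func) : Guard OVar → Prop
  | .tru => True
  | .eq x y => ∃ v, x.eval φ e = some v ∧ y.eval φ e = some v
  | .neg g => ¬ g.Sat φ e
  | .conj g g' => g.Sat φ e ∧ g'.Sat φ e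
  | .disj g g' => g.Sat φ e ∨ g'.Sat φ e

/-- Transitions of an observer. -/
structure Transition (Func OLoc OVar : Type*) where
  src : OLoc
  kind : EvKind Func
  guard : Guard OVar
  dst : OLoc

/-- Observer automata. -/
structure Observer (Func OLoc OVar : Type*) where
  start : OLoc
  accepting : Set OLoc
  trans : Set (Transition Func OLoc OVar)

namespace Observer

variable {Thread Adr Dom Func OLoc OVar : Type*}

/-- `(l, φ) →ʰ (l', φ)`: the valuation `φ` of the observer variables does not change. -/
inductive Run (O : Observer Func OLoc OVar) (φ : OVar → Value Thread Adr Dom) :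
    OLoc → List (Event Thread Adr Dom Func) → OLoc → Prop
  | nil (l : OLoc) : Run O φ l [] l
  | cons {l' : OLoc} {h : List (Event Thread Adr Dom Func)}
      (tr : Transition Func OLoc OVar) (e : Event Thread Adr Dom Func)
      (mem : tr ∈ O.trans) (kind : tr.kind = e.kind) (sat : tr.guard.Sat φ e)
      (rest : Run O φ tr.dst h l') : Run O φ tr.src (e :: h) l'

/-- The specification of `O`: the histories that are accepted from no initial state, the
initial valuation of the observer variables being arbitrary. -/
def spec (O : Observer Func OLoc OVar) : Set (List (Event Thread Adr Dom Func)) :=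
  {h | ∀ (φ : OVar → Value Thread Adr Dom) (l : OLoc), O.Run φ O.start h l → l ∉ O.accepting}

/-- The behavior `𝓕(h, a)` allowed by `O` on address `a` after history `h`. -/
def behavior (O : Observer Func OLoc OVar) (h : List (Event Thread Adr Dom Func)) (a : Adr) :
    Set (List (Event Thread Adr Dom Func)) :=
  {h' | h ++ h' ∈ O.spec ∧ ∀ b, Event.free b ∈ h' → b = a}

end Observer

/-- The addresses that do not occur in a history. -/
def histFresh {Thread Adr Dom Func : Type*} (h : List (Event Thread Adr Dom Func)) : Set Adr :=
  {b | ∀ e ∈ h, b ∉ e.adrs}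

/-- The addresses whose last occurrence in a history is in a `free`. -/
def histFreed {Thread Adr Dom Func : Type*} (h : List (Event Thread Adr Dom Func)) : Set Adr :=
  {b | ∃ h₁ h₂, h = h₁ ++ Event.free b :: h₂ ∧ b ∈ histFresh h₂}

/-- Elision support. -/
structure SupportsElision (Thread Adr Dom : Type*) {Func OLoc OVar : Type*}
    (O : Observer Func OLoc OVar) : Prop where
  replace : ∀ (h₁ h₂ : List (Event Thread Adr Dom Func)) (a b c : Adr), a ≠ c → c ≠ b →
    h₂ = h₁.map (Event.rename a b) → O.behavior h₁ c = O.behavior h₂ c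
  fresh : ∀ (h₁ h₂ : List (Event Thread Adr Dom Func)) (a b : Adr),
    O.behavior h₁ a ⊆ O.behavior h₂ a → b ∈ histFresh h₁ ∪ histFreed h₁ → b ∈ histFresh h₂ →
    O.behavior h₁ b ⊆ O.behavior h₂ b
  free : ∀ (h : List (Event Thread Adr Dom Func)) (a b : Adr), a ≠ b →
    h ++ [Event.free a] ∈ O.spec →
    O.behavior (h ++ [Event.free a]) b = O.behavior h b

/-! ### Programs and their semantics -/

/-- The control flow of a data structure: thread `t` at location `l` may execute `c` iff
`next t l c` is defined, and then moves to that location. -/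
structure Program (Thread PVar DVar Dom Func Loc : Type*) where
  start : Thread → Loc
  next : Thread → Loc → Com PVar DVar Dom Func → Option Loc

namespace Comp

variable {Thread PVar DVar Adr Dom Func Loc OLoc OVar : Type*}

/-- The memory after a computation. -/
noncomputable def mem [Zero Dom] : Comp Thread PVar DVar Adr Dom Func → Memory PVar DVar Adr Dom
  | nil => Memory.initial
  | snoc τ act => τ.mem.apply act.up

/-- The addresses that have never been allocated or freed. -/
noncomputable def fresh [Zero Dom] : Comp Thread PVar DVar Adr Dom Func → Set Adr
  | nil => Set.univ
  | snoc τ act =>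
    match act.cmd with
    | .free a => τ.fresh \ {a}
    | .prog (.malloc p) => τ.fresh \ {a | (snoc τ act).mem.adrOf p = some a}
    | _ => τ.fresh

/-- The addresses that have been freed since their last allocation. -/
noncomputable def freed [Zero Dom] : Comp Thread PVar DVar Adr Dom Func → Set Adr
  | nil => ∅
  | snoc τ act =>
    match act.cmd with
    | .free a => τ.freed ∪ {a}
    | .prog (.malloc p) => τ.freed \ {a | (snoc τ act).mem.adrOf p = some a}
    | _ => τ.freed

/-- The induced history. Calls are enabled only if all their arguments evaluate, so that
`filterMap` evaluates the argument lists entry by entry. -/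
noncomputable def history [Zero Dom] :
    Comp Thread PVar DVar Adr Dom Func → List (Event Thread Adr Dom Func)
  | nil => []
  | snoc τ act =>
    match act.cmd with
    | .free a => τ.history ++ [.free a]
    | .prog (.enter f ps xs) =>
        τ.history ++ [.call f act.thread (ps.filterMap τ.mem.adrOf)
          (xs.filterMap fun x => τ.mem.dat (.var x))]
    | .prog .exit => τ.history ++ [.exit act.thread]
    | _ => τ.history

open Classical in
/-- The valid pointer expressions. -/
noncomputable def valid [Zero Dom] : Comp Thread PVar DVar Adr Dom Func → Set (PExp PVar Adr)
  | nil => Set.range PExp.var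
  | snoc τ act =>
    match act.cmd with
    | .prog (.assign p q) =>
        if .var q ∈ τ.valid then τ.valid ∪ {.var p} else τ.valid \ {.var p}
    | .prog (.store p q) =>
        match τ.mem.adrOf p with
        | some a => if .var q ∈ τ.valid then τ.valid ∪ {.sel a} else τ.valid \ {.sel a}
        | none => τ.valid
    | .prog (.load p q) =>
        match τ.mem.adrOf q with
        | some a => if .sel a ∈ τ.valid then τ.valid ∪ {.var p} else τ.valid \ {.var p}
        | none => τ.valid
    | .free a => τ.valid \ ({e | τ.mem.ptr e = some (.adr a)} ∪ {.sel a})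
    | .prog (.malloc p) =>
        match (snoc τ act).mem.adrOf p with
        | some a => τ.valid ∪ {.var p, .sel a}
        | none => τ.valid
    | .prog (.assert (.peq p q)) =>
        if .var p ∈ τ.valid ∨ .var q ∈ τ.valid then τ.valid ∪ {.var p, .var q} else τ.valid
    | _ => τ.valid

/-- The valid addresses: the in-use addresses of the valid memory. -/
noncomputable def validAdrs [Zero Dom] (τ : Comp Thread PVar DVar Adr Dom Func) : Set Adr :=
  (τ.mem.restrict τ.valid).adrs

open Classical in
/-- The control locations of the threads. Environment frees do not affect control. -/
noncomputable def ctrl (D : Program Thread PVar DVar Dom Func Loc) :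
    Comp Thread PVar DVar Adr Dom Func → Thread → Loc
  | nil => D.start
  | snoc τ act =>
    match act.cmd with
    | .prog c => Function.update (τ.ctrl D) act.thread
        ((D.next act.thread (τ.ctrl D act.thread) c).getD (τ.ctrl D act.thread))
    | .free _ => τ.ctrl D

end Comp

/-- `Enabled τ X c up`: the data structure command `c` can be executed with memory update `up`
after `τ`, as far as memory is concerned, where the addresses in `X` may be reused. -/
inductive Enabled {Thread PVar DVar Adr Dom Func : Type*} [Zero Dom] [LT Dom]
    (τ : Comp Thread PVar DVar Adr Dom Func) (X : Set Adr) :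
    Com PVar DVar Dom Func → List (Upd PVar DVar Adr Dom) → Prop
  | malloc (p : PVar) (a : Adr) (d : Dom) (ha : a ∈ τ.fresh ∨ a ∈ τ.freed ∩ X) :
      Enabled τ X (.malloc p)
        [.ptr (.var p) (some (.adr a)), .ptr (.sel a) (some .seg), .dat (.sel a) (some d)]
  | enter (f : Func) (ps : List PVar) (xs : List DVar)
      (hps : ∀ p ∈ ps, ∃ a, τ.mem.ptr (.var p) = some (.adr a))
      (hxs : ∀ x ∈ xs, ∃ d, τ.mem.dat (.var x) = some d) :
      Enabled τ X (.enter f ps xs) []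
  | exit : Enabled τ X .exit []
  | assign (p q : PVar) : Enabled τ X (.assign p q) [.ptr (.var p) (τ.mem.ptr (.var q))]
  | store (p q : PVar) (a : Adr) (hp : τ.mem.ptr (.var p) = some (.adr a)) :
      Enabled τ X (.store p q) [.ptr (.sel a) (τ.mem.ptr (.var q))]
  | load (p q : PVar) (a : Adr) (hq : τ.mem.ptr (.var q) = some (.adr a)) :
      Enabled τ X (.load p q) [.ptr (.var p) (τ.mem.ptr (.sel a))]
  | op (x : DVar) (f : List Dom → Dom) (ys : List DVar) (ds : List Dom)
      (hys : List.Forall₂ (fun y d => τ.mem.dat (.var y) = some d) ys ds) :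
      Enabled τ X (.op x f ys) [.dat (.var x) (some (f ds))]
  | storeData (p : PVar) (y : DVar) (a : Adr) (hp : τ.mem.ptr (.var p) = some (.adr a)) :
      Enabled τ X (.storeData p y) [.dat (.sel a) (τ.mem.dat (.var y))]
  | loadData (x : DVar) (q : PVar) (a : Adr) (hq : τ.mem.ptr (.var q) = some (.adr a)) :
      Enabled τ X (.loadData x q) [.dat (.var x) (τ.mem.dat (.sel a))]
  | assert (c : Cond PVar DVar) (hc : c.Holds τ.mem) : Enabled τ X (.assert c) []

section Semantics

variable {Thread PVar DVar Adr Dom Func Loc OLoc OVar : Type*} [Zero Dom] [LT Dom]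

/-- `Sem D O X` is the set of computations of the data structure `D` relative to the observer `O`
in which only the addresses from `X` may be reused. -/
inductive Sem (D : Program Thread PVar DVar Dom Func Loc) (O : Observer Func OLoc OVar)
    (X : Set Adr) : Comp Thread PVar DVar Adr Dom Func → Prop
  | nil : Sem D O X .nil
  | prog {τ : Comp Thread PVar DVar Adr Dom Func} (t : Thread) (c : Com PVar DVar Dom Func)
      (up : List (Upd PVar DVar Adr Dom)) (hτ : Sem D O X τ)
      (hctrl : D.next t (τ.ctrl D t) c ≠ none) (hc : Enabled τ X c up) :
      Sem D O X (τ.snoc ⟨t, .prog c, up⟩)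
  | free {τ : Comp Thread PVar DVar Adr Dom Func} (t : Thread) (a : Adr) (hτ : Sem D O X τ)
      (ha : τ.history ++ [Event.free a] ∈ O.spec) :
      Sem D O X (τ.snoc ⟨t, .free a, [.ptr (.sel a) none, .dat (.sel a) none]⟩)

end Semantics

section Relations

variable {Thread PVar DVar Adr Dom Func Loc OLoc OVar : Type*} [Zero Dom]

/-- Similarity `τ ∼ σ`: equal control locations and equal valid memory. -/
def Similar (D : Program Thread PVar DVar Dom Func Loc)
    (τ σ : Comp Thread PVar DVar Adr Dom Func) : Prop :=
  τ.ctrl D = σ.ctrl D ∧ τ.mem.restrict τ.valid = σ.mem.restrict σ.valid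

/-- Observer behavior inclusion `τ ⊑ σ`. -/
def BehaviorIncl (O : Observer Func OLoc OVar)
    (τ σ : Comp Thread PVar DVar Adr Dom Func) : Prop :=
  ∀ a ∈ τ.validAdrs, O.behavior τ.history a ⊆ O.behavior σ.history a

/-- Memory equivalence `τ ≡ₐ σ` with respect to the address `a`. -/
def MemEquiv (O : Observer Func OLoc OVar) (a : Adr)
    (τ σ : Comp Thread PVar DVar Adr Dom Func) : Prop :=
  (∀ p : PVar, τ.mem.ptr (.var p) = some (.adr a) ↔ σ.mem.ptr (.var p) = some (.adr a)) ∧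
  (∀ b ∈ τ.mem.image τ.valid,
    τ.mem.ptr (.sel b) = some (.adr a) ↔ σ.mem.ptr (.sel b) = some (.adr a)) ∧
  (a ∈ τ.fresh ∪ τ.freed ↔ a ∈ σ.fresh ∪ σ.freed) ∧
  O.behavior τ.history a ⊆ O.behavior σ.history a

/-- The pointer variables whose selectors a command accesses. -/
def Com.derefs : Com PVar DVar Dom Func → Set PVar
  | .store p _ => {p}
  | .load _ q => {q}
  | .storeData p _ => {p}
  | .loadData _ q => {q}
  | _ => ∅

/-- `τ.act` performs an unsafe access. -/
def UnsafeAccess (τ : Comp Thread PVar DVar Adr Dom Func)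
    (act : Action Thread PVar DVar Adr Dom Func) : Prop :=
  ∃ c, act.cmd = .prog c ∧ ∃ p ∈ c.derefs, .var p ∉ τ.valid

/-- `τ.act` performs a racy SMR call. -/
def RacyCall (O : Observer Func OLoc OVar) (τ : Comp Thread PVar DVar Adr Dom Func)
    (act : Action Thread PVar DVar Adr Dom Func) : Prop :=
  ∃ (f : Func) (ps : List PVar) (xs : List DVar) (as : List Adr) (ds : List Dom),
    act.cmd = .prog (.enter f ps xs) ∧
    List.Forall₂ (fun p a => τ.mem.ptr (.var p) = some (.adr a)) ps as ∧
    List.Forall₂ (fun x d => τ.mem.dat (.var x) = some d) xs ds ∧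
    ∃ (c : Adr) (bs : List Adr), bs.length = as.length ∧
      (∀ (i : ℕ) (p : PVar) (a b : Adr), ps[i]? = some p → as[i]? = some a → bs[i]? = some b →
        (a = c ∨ .var p ∈ τ.valid) → a = b) ∧
      ¬ O.behavior (τ.history ++ [Event.call f act.thread bs ds]) c ⊆
        O.behavior (τ.history ++ [Event.call f act.thread as ds]) c

/-- `τ.act` is a pointer race. -/
def PointerRace (O : Observer Func OLoc OVar) (τ : Comp Thread PVar DVar Adr Dom Func)
    (act : Action Thread PVar DVar Adr Dom Func) : Prop :=
  UnsafeAccess τ act ∨ RacyCall O τ act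

end Relations

section Freedom

variable {Thread PVar DVar Dom Func Loc OLoc OVar : Type*} [Zero Dom] [LT Dom]

/-- No computation that reuses at most a single address is a pointer race. -/
def PointerRaceFree (Adr : Type*) (D : Program Thread PVar DVar Dom Func Loc)
    (O : Observer Func OLoc OVar) : Prop :=
  ∀ (a : Adr) (τ : Comp Thread PVar DVar Adr Dom Func)
    (act : Action Thread PVar DVar Adr Dom Func),
    Sem D O {a} (τ.snoc act) → ¬ PointerRace O τ act

/-- The computations that reuse at most a single address are free from harmful ABAs. -/
def HarmfulABAFree (Adr : Type*) (D : Program Thread PVar DVar Dom Func Loc)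
    (O : Observer Func OLoc OVar) : Prop :=
  ∀ (a b : Adr) (σa : Comp Thread PVar DVar Adr Dom Func)
    (act : Action Thread PVar DVar Adr Dom Func) (σb : Comp Thread PVar DVar Adr Dom Func),
    Sem D O {a} (σa.snoc act) → Sem D O {b} σb →
    Similar D σa σb → (∃ c, act.cmd = .prog (.assert c)) →
    ∃ σb' : Comp Thread PVar DVar Adr Dom Func, Sem D O {b} σb' ∧
      Similar D (σa.snoc act) σb' ∧ MemEquiv O b σb σb' ∧ BehaviorIncl O (σa.snoc act) σb'

end Freedom

end SMR

/-! By induction on `τ`, for all `a` at once, one constructs a `σ` that reuses only `a` and is tied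
to `τ` by `Rel`, which is stronger than the three required relations (`exists_rel`). Having every
`a` available in the induction hypothesis is essential, because some steps of `τ` are justified
through the `σ` of a well-chosen address. If `τ` dereferences `p` holding `b`, then `p` holds `b` in
the `σ` for `b` too, the access is possible there, and race freedom makes `p` valid in `σ`, hence in
`τ`. If `τ` passes an assertion, some address has a `σ` that passes it as well
(`Cond.exists_holds`), and the absence of harmful ABAs carries the outcome to every other address
(`Rel.exists_assert`).

All other commands except allocations are copied (`Rel.prog`). A free of `a` or of a valid address
is copied, any other free is dropped (`Rel.free_right`, `Rel.free_left`). For an allocation of `b ≠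
a`, first swap `b` in `σ` with an address fresh there; neither `a` nor the valid memory is touched
(`Rel.perm_right`), and `b` may now be allocated in `σ`.

Then `b` becomes valid, so its behavior after `τ` must be included in its behavior after the renamed
`σ`. Elision support yields this at once only if `b` is new to the history of `τ` or occurs there
last in a free; but a dangling pointer to `b` may have been passed to a call since. Therefore `Rel`
also carries `Transfer` for every address that `τ` could allocate. Calls preserve it
(`Transfer.append`): rename `b` to a new address `c`, and use that the call of `σ` is not racy with
respect to `c`. -/

namespace SMR

/-! ### Address permutations of events, and observers -/

section Permutations

variable {Thread Adr Dom Func OLoc OVar : Type*}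

/-- Apply a permutation of the addresses to a value. -/
def Value.perm (π : Equiv.Perm Adr) : Value Thread Adr Dom → Value Thread Adr Dom
  | thr t => thr t
  | adr a => adr (π a)
  | dat d => dat d

/-- Apply a permutation of the addresses to an event. -/
def Event.perm (π : Equiv.Perm Adr) : Event Thread Adr Dom Func → Event Thread Adr Dom Func
  | call f t as ds => call f t (as.map π) ds
  | exit t => exit t
  | free c => free (π c)

theorem Value.perm_injective (π : Equiv.Perm Adr) :
    Function.Injective (Value.perm (Thread := Thread) (Dom := Dom) π) := by
  intro x y h
  cases x <;> cases y <;> simp_all [Value.perm]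

@[simp] theorem Value.perm_symm_perm (π : Equiv.Perm Adr) (v : Value Thread Adr Dom) :
    (v.perm π.symm).perm π = v := by
  cases v <;> simp [Value.perm]

@[simp] theorem Event.perm_symm_perm (π : Equiv.Perm Adr) (e : Event Thread Adr Dom Func) :
    (e.perm π).perm π.symm = e := by
  cases e <;> simp [Event.perm]

@[simp] theorem Event.kind_perm (π : Equiv.Perm Adr) (e : Event Thread Adr Dom Func) :
    (e.perm π).kind = e.kind := by
  cases e <;> rfl

@[simp] theorem Event.adrs_perm (π : Equiv.Perm Adr) (e : Event Thread Adr Dom Func) :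
    (e.perm π).adrs = e.adrs.map π := by
  cases e <;> rfl

theorem map_eq_self {α : Type*} {f : α → α} {l : List α} (h : ∀ x ∈ l, f x = x) :
    l.map f = l := by
  simpa using List.map_congr_left (g := id) h

theorem Event.perm_eq_self {π : Equiv.Perm Adr} {e : Event Thread Adr Dom Func}
    (h : ∀ a ∈ e.adrs, π a = a) : e.perm π = e := by
  cases e with
  | call f t as ds => simpa [Event.perm, Event.adrs] using map_eq_self h
  | exit t => rfl
  | free a => simpa [Event.perm, Event.adrs] using h

@[simp] theorem map_perm_symm_map_perm (π : Equiv.Perm Adr) (h : List (Event Thread Adr Dom Func)) :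
    (h.map (Event.perm π)).map (Event.perm π.symm) = h := by
  rw [List.map_map]
  exact map_eq_self fun e _ => Event.perm_symm_perm π e

open Classical in
theorem Event.rename_eq_perm (a b : Adr) :
    Event.rename (Thread := Thread) (Dom := Dom) (Func := Func) a b =
      Event.perm (Equiv.swap a b) := by
  funext e
  cases e <;> rfl

theorem Term.eval_perm (π : Equiv.Perm Adr) (φ : OVar → Value Thread Adr Dom)
    (e : Event Thread Adr Dom Func) (x : Term OVar) :
    x.eval (fun v => (φ v).perm π) (e.perm π) = (x.eval φ e).map (Value.perm π) := by
  cases x with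
  | var v => rfl
  | thread => cases e <;> rfl
  | adrArg i => simp [Term.eval, Function.comp_def, Value.perm]
  | datArg i => cases e <;> simp [Term.eval, Event.perm, Event.dats, Function.comp_def, Value.perm]

/-- Guards only test equalities, and a permutation acts injectively on values. -/
theorem Guard.sat_perm (π : Equiv.Perm Adr) (φ : OVar → Value Thread Adr Dom)
    (e : Event Thread Adr Dom Func) (g : Guard OVar) :
    g.Sat (fun v => (φ v).perm π) (e.perm π) ↔ g.Sat φ e := by
  induction g with
  | tru => rfl
  | eq x y =>
    simp only [Guard.Sat, Term.eval_perm, Option.map_eq_some_iff]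
    constructor
    · rintro ⟨_, ⟨v, hv, rfl⟩, w, hw, hwv⟩
      exact ⟨v, hv, by rw [hw, Value.perm_injective π hwv]⟩
    · rintro ⟨v, hv, hw⟩
      exact ⟨_, ⟨v, hv, rfl⟩, v, hw, rfl⟩
  | neg g ih => simp [Guard.Sat, ih]
  | conj g g' ih ih' => simp [Guard.Sat, ih, ih']
  | disj g g' ih ih' => simp [Guard.Sat, ih, ih']

namespace Observer

variable {O : Observer Func OLoc OVar}

theorem Run.perm (π : Equiv.Perm Adr) {φ : OVar → Value Thread Adr Dom} {l l' : OLoc}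
    {h : List (Event Thread Adr Dom Func)} (hr : O.Run φ l h l') :
    O.Run (fun v => (φ v).perm π) l (h.map (Event.perm π)) l' := by
  induction hr with
  | nil l => exact .nil l
  | cons tr e mem kind sat _ ih =>
    exact .cons tr _ mem (by simpa using kind) ((Guard.sat_perm π φ e _).2 sat) ih

/-- The initial valuation is arbitrary, so an accepting run on the renamed history can be renamed
back. -/
theorem map_perm_mem_spec (π : Equiv.Perm Adr) {h : List (Event Thread Adr Dom Func)}
    (hs : h ∈ O.spec) : h.map (Event.perm π) ∈ O.spec := by
  intro φ l hr
  have := hr.perm π.symm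
  rw [map_perm_symm_map_perm] at this
  exact hs _ l this

theorem map_perm_mem_behavior (π : Equiv.Perm Adr) {h h' : List (Event Thread Adr Dom Func)}
    {a : Adr} (hb : h' ∈ O.behavior h a) :
    h'.map (Event.perm π) ∈ O.behavior (h.map (Event.perm π)) (π a) := by
  refine ⟨by simpa using map_perm_mem_spec π hb.1, fun b hbm => ?_⟩
  obtain ⟨e, he, heq⟩ := List.mem_map.1 hbm
  cases e with
  | call => simp [Event.perm] at heq
  | exit => simp [Event.perm] at heq
  | free c =>
    simp only [Event.perm, Event.free.injEq] at heq
    rw [← heq, hb.2 c he]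

/-- Inclusions of behaviors are invariant under permutations of the addresses. -/
theorem behavior_subset_perm (π : Equiv.Perm Adr) {h₁ h₂ : List (Event Thread Adr Dom Func)}
    {a : Adr} (hb : O.behavior h₁ a ⊆ O.behavior h₂ a) :
    O.behavior (h₁.map (Event.perm π)) (π a) ⊆ O.behavior (h₂.map (Event.perm π)) (π a) := by
  intro h' hh'
  have h1 := map_perm_mem_behavior π.symm hh'
  rw [map_perm_symm_map_perm, Equiv.symm_apply_apply] at h1
  have h2 := map_perm_mem_behavior π (hb h1)
  have h3 := map_perm_symm_map_perm π.symm h'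
  rw [Equiv.symm_symm] at h3
  rwa [h3] at h2

/-- The event `e` can be counted as the first event of the continuation, provided that it frees
nothing but `a`. -/
theorem behavior_subset_append {h₁ h₂ : List (Event Thread Adr Dom Func)} {a : Adr}
    (hb : O.behavior h₁ a ⊆ O.behavior h₂ a) {e : Event Thread Adr Dom Func}
    (he : ∀ b, e = .free b → b = a) :
    O.behavior (h₁ ++ [e]) a ⊆ O.behavior (h₂ ++ [e]) a := by
  intro h' hh'
  have h1 : e :: h' ∈ O.behavior h₁ a := by
    refine ⟨by simpa using hh'.1, fun b hbm => ?_⟩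
    rcases List.mem_cons.1 hbm with h | h
    · exact he b h.symm
    · exact hh'.2 b h
  exact ⟨by simpa using (hb h1).1, hh'.2⟩

theorem free_mem_spec_of_behavior_subset {h₁ h₂ : List (Event Thread Adr Dom Func)} {a : Adr}
    (hb : O.behavior h₁ a ⊆ O.behavior h₂ a) (hs : h₁ ++ [Event.free a] ∈ O.spec) :
    h₂ ++ [Event.free a] ∈ O.spec :=
  (hb (show [Event.free a] ∈ O.behavior h₁ a from ⟨hs, by simp⟩)).1

end Observer

end Permutations

/-! ### Consequences of elision support -/

section Elision

variable {Thread Adr Dom Func OLoc OVar : Type*}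

theorem histFresh_append (h₁ h₂ : List (Event Thread Adr Dom Func)) :
    histFresh (h₁ ++ h₂) = histFresh h₁ ∩ histFresh h₂ := by
  ext b
  simp only [histFresh, Set.mem_ofPred_eq, Set.mem_inter_iff, List.mem_append]
  grind

theorem mem_histFresh_singleton {e : Event Thread Adr Dom Func} {b : Adr} :
    b ∈ histFresh [e] ↔ b ∉ e.adrs := by
  simp [histFresh]

theorem finite_compl_histFresh (h : List (Event Thread Adr Dom Func)) :
    (histFresh h)ᶜ.Finite := by
  have : (histFresh h)ᶜ ⊆ {b | b ∈ h.flatMap Event.adrs} := by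
    intro b hb
    simpa [histFresh] using hb
  exact (List.finite_toSet _).subset this

theorem exists_histFresh [Infinite Adr] (h₁ h₂ h₃ : List (Event Thread Adr Dom Func))
    {s : Set Adr} (hs : s.Finite) :
    ∃ d, d ∈ histFresh h₁ ∧ d ∈ histFresh h₂ ∧ d ∈ histFresh h₃ ∧ d ∉ s := by
  have hfin := (((finite_compl_histFresh h₁).union (finite_compl_histFresh h₂)).union
    (finite_compl_histFresh h₃)).union hs
  obtain ⟨d, hd⟩ := hfin.exists_notMem
  simp only [Set.mem_union, Set.mem_compl_iff, not_or, not_not] at hd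
  exact ⟨d, hd.1.1.1, hd.1.1.2, hd.1.2, hd.2⟩

open Classical in
theorem map_perm_swap_eq_self {h : List (Event Thread Adr Dom Func)} {b c : Adr}
    (hb : b ∈ histFresh h) (hc : c ∈ histFresh h) :
    h.map (Event.perm (Equiv.swap b c)) = h := by
  refine map_eq_self fun e he => ?_
  refine Event.perm_eq_self fun a ha => Equiv.swap_apply_of_ne_of_ne ?_ ?_
  · rintro rfl; exact hb e he ha
  · rintro rfl; exact hc e he ha

open Classical in
theorem left_mem_histFresh_map_perm_swap {h : List (Event Thread Adr Dom Func)} {b c : Adr}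
    (hc : c ∈ histFresh h) : b ∈ histFresh (h.map (Event.perm (Equiv.swap b c))) := by
  intro e he hb
  obtain ⟨e', he', rfl⟩ := List.mem_map.1 he
  rw [Event.adrs_perm] at hb
  obtain ⟨x, hx, hxb⟩ := List.mem_map.1 hb
  have : x = c := by
    rw [← (Equiv.swap b c).injective.eq_iff, hxb, Equiv.swap_apply_right]
  exact hc e' he' (this ▸ hx)

variable (O : Observer Func OLoc OVar)

/-- Inclusion of the behaviors on the addresses that occur in neither history. -/
def FreshIncl (h₁ h₂ : List (Event Thread Adr Dom Func)) : Prop :=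
  ∀ d, d ∈ histFresh h₁ → d ∈ histFresh h₂ → O.behavior h₁ d ⊆ O.behavior h₂ d

/-- The behavior of `b` after `h₁` is allowed after every history which does not contain `b` and
allows as much on new addresses as `h₂`. -/
def Transfer (h₁ h₂ : List (Event Thread Adr Dom Func)) (b : Adr) : Prop :=
  ∀ h, FreshIncl O h₂ h → b ∈ histFresh h → O.behavior h₁ b ⊆ O.behavior h b

variable {O}

/-- The inclusion at one address `d`, whether or not it occurs in the histories, spreads to all
unused addresses. -/
theorem SupportsElision.freshIncl (E : SupportsElision Thread Adr Dom O)
    {h₁ h₂ : List (Event Thread Adr Dom Func)} {d : Adr}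
    (hd : O.behavior h₁ d ⊆ O.behavior h₂ d) : FreshIncl O h₁ h₂ :=
  fun b hb hb' => E.fresh h₁ h₂ d b hd (.inl hb) hb'

/-- Chaining is possible only at an address that is new to the middle history too; one such address
is enough. -/
theorem SupportsElision.freshIncl_trans [Infinite Adr] (E : SupportsElision Thread Adr Dom O)
    {h₁ h₂ h₃ : List (Event Thread Adr Dom Func)}
    (h12 : FreshIncl O h₁ h₂) (h23 : FreshIncl O h₂ h₃) : FreshIncl O h₁ h₃ := by
  obtain ⟨d, h1, h2, h3, -⟩ := exists_histFresh h₁ h₂ h₃ Set.finite_empty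
  exact E.freshIncl ((h12 d h1 h2).trans (h23 d h2 h3))

open Classical in
theorem SupportsElision.behavior_map_perm_swap (E : SupportsElision Thread Adr Dom O)
    (h : List (Event Thread Adr Dom Func)) {a b c : Adr} (ha : a ≠ c) (hb : b ≠ c) :
    O.behavior (h.map (Event.perm (Equiv.swap a b))) c = O.behavior h c :=
  (E.replace h _ a b c ha hb.symm (by rw [Event.rename_eq_perm])).symm

open Classical in
theorem SupportsElision.freshIncl_map_perm_swap [Infinite Adr]
    (E : SupportsElision Thread Adr Dom O)
    (h : List (Event Thread Adr Dom Func)) (a b : Adr) :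
    FreshIncl O h (h.map (Event.perm (Equiv.swap a b))) := by
  obtain ⟨d, hd⟩ := (Set.toFinite {a, b}).exists_notMem
  simp only [Set.mem_insert_iff, Set.mem_singleton_iff, not_or] at hd
  exact E.freshIncl (d := d) (E.behavior_map_perm_swap h (Ne.symm hd.1) (Ne.symm hd.2)).ge

theorem SupportsElision.freshIncl_append_free [Infinite Adr]
    (E : SupportsElision Thread Adr Dom O)
    {h : List (Event Thread Adr Dom Func)} {a : Adr} (hs : h ++ [.free a] ∈ O.spec) :
    FreshIncl O h (h ++ [.free a]) := by
  obtain ⟨d, hd⟩ := (Set.finite_singleton a).exists_notMem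
  exact E.freshIncl (d := d) (E.free h a d (Ne.symm hd) hs).ge

theorem SupportsElision.append_free_freshIncl [Infinite Adr]
    (E : SupportsElision Thread Adr Dom O)
    {h : List (Event Thread Adr Dom Func)} {a : Adr} (hs : h ++ [.free a] ∈ O.spec) :
    FreshIncl O (h ++ [.free a]) h := by
  obtain ⟨d, hd⟩ := (Set.finite_singleton a).exists_notMem
  exact E.freshIncl (d := d) (E.free h a d (Ne.symm hd) hs).le

/-- This is why `Transfer` quantifies over all suitable histories: the mimicking computation may be
renamed or replaced by another one without losing it. -/
theorem Transfer.mono [Infinite Adr] (E : SupportsElision Thread Adr Dom O)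
    {h₁ h₂ h₃ : List (Event Thread Adr Dom Func)} {b : Adr}
    (ht : Transfer O h₁ h₂ b) (h23 : FreshIncl O h₂ h₃) : Transfer O h₁ h₃ b :=
  fun h hh hb => ht h (E.freshIncl_trans h23 hh) hb

/-- Freeing `b` itself makes the last occurrence of `b` a free, so that elision support applies and
nothing need be known beforehand. Frees of other addresses do not affect the behavior on `b`. -/
theorem Transfer.append_free [Infinite Adr] (E : SupportsElision Thread Adr Dom O)
    {h₁ h₂ : List (Event Thread Adr Dom Func)} {a b : Adr}
    (hs : h₁ ++ [.free a] ∈ O.spec) (hincl : FreshIncl O h₁ h₂)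
    (ht : b ≠ a → Transfer O h₁ h₂ b) : Transfer O (h₁ ++ [.free a]) h₂ b := by
  intro h hh hb
  by_cases hba : b = a
  · subst hba
    obtain ⟨d, hd1, hd2, -, -⟩ := exists_histFresh (h₁ ++ [.free b]) h h Set.finite_empty
    refine E.fresh _ h d b (E.freshIncl_trans (E.append_free_freshIncl hs)
      (E.freshIncl_trans hincl hh) d hd1 hd2) (.inr ⟨h₁, [], rfl, ?_⟩) hb
    simp [histFresh]
  · rw [E.free h₁ a b (Ne.symm hba) hs]
    exact ht hba h hh hb

open Classical in
-- The two events may differ in their addresses, and `e₁` may mention `b`. Swapping `b` with an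
-- address `c` new to the right-hand history moves the comparison to `c`, where `hev` applies; for
-- calls, `hev` will be an instance of race freedom.
theorem Transfer.append [Infinite Adr] (E : SupportsElision Thread Adr Dom O)
    {h₁ h₂ : List (Event Thread Adr Dom Func)} {b : Adr} {e₁ e₂ : Event Thread Adr Dom Func}
    (ht : Transfer O h₁ h₂ b) (he : ∀ c, e₁ ≠ .free c)
    (hev : ∀ c ∈ histFresh (h₂ ++ [e₂]), c ≠ b →
      O.behavior (h₂ ++ [e₁.perm (Equiv.swap b c)]) c ⊆ O.behavior (h₂ ++ [e₂]) c) :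
    Transfer O (h₁ ++ [e₁]) (h₂ ++ [e₂]) b := by
  intro h hh hb
  obtain ⟨c, hc1, hc2, -, hcb⟩ := exists_histFresh (h₂ ++ [e₂]) h h (Set.finite_singleton b)
  have hc3 : c ∈ histFresh h₂ := by
    rw [histFresh_append] at hc1
    exact hc1.1
  -- After the swap `b` no longer occurs in `h₂`, and behaviors on new addresses are unchanged, so
  -- `ht` applies to the renamed history.
  have h1 : O.behavior h₁ b ⊆ O.behavior (h₂.map (Event.perm (Equiv.swap b c))) b :=
    ht _ (E.freshIncl_map_perm_swap h₂ b c) (left_mem_histFresh_map_perm_swap hc3)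
  refine (O.behavior_subset_append h1 fun c hc => absurd hc (he c)).trans ?_
  -- The inclusions at `c` are renamed back to `b`; `h` contains neither address and stays fixed.
  have h2 := O.behavior_subset_perm (Equiv.swap b c) ((hev c hc1 hcb).trans (hh c hc1 hc2))
  rw [Equiv.swap_apply_right, map_perm_swap_eq_self hb hc2] at h2
  have h3 := Event.perm_symm_perm (Equiv.swap b c) e₁
  rw [Equiv.symm_swap] at h3
  simpa [h3] using h2

end Elision

/-! ### Valid addresses and invariants of computations -/

section Invariants

variable {Thread PVar DVar Adr Dom Func Loc OLoc OVar : Type*} [Zero Dom]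

omit [Zero Dom] in
theorem Memory.adrOf_eq_some {m : Memory PVar DVar Adr Dom} {p : PVar} {a : Adr} :
    m.adrOf p = some a ↔ m.ptr (.var p) = some (.adr a) := by
  unfold Memory.adrOf
  split <;> simp_all

/-- `a` is held by a valid pointer expression, or has a valid selector. -/
def ValidAdr (τ : Comp Thread PVar DVar Adr Dom Func) (a : Adr) : Prop :=
  a ∈ τ.mem.image τ.valid ∨ PExp.sel a ∈ τ.valid

/-- The properties of memory and validity which hold as long as there are no unsafe accesses. -/
structure Inv (τ : Comp Thread PVar DVar Adr Dom Func) : Prop where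
  var_def : ∀ p, τ.mem.ptr (.var p) ≠ none
  sel_def : ∀ b ∈ τ.mem.image τ.valid, τ.mem.ptr (.sel b) ≠ none
  valid_def : ∀ e ∈ τ.valid, τ.mem.ptr e ≠ none
  fresh_ne : ∀ b ∈ τ.fresh, ∀ e, τ.mem.ptr e ≠ some (.adr b)
  not_validAdr : ∀ b ∈ τ.fresh ∪ τ.freed, ¬ ValidAdr τ b
  histFresh : ∀ b ∈ τ.fresh, b ∈ histFresh τ.history
  seg_valid : ∀ e, τ.mem.ptr e = some .seg → e ∈ τ.valid

/-- Invalid pointers hold no valid address but `a`. -/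
def InvOnly (a : Adr) (τ : Comp Thread PVar DVar Adr Dom Func) : Prop :=
  ∀ e c, τ.mem.ptr e = some (.adr c) → e ∉ τ.valid → c ≠ a → ¬ ValidAdr τ c

/-- In `τ'` the pointer expression `e` has the value and the validity which `s e` has in `τ`. -/
structure Moves (τ τ' : Comp Thread PVar DVar Adr Dom Func) (s : PExp PVar Adr → PExp PVar Adr) :
    Prop where
  ptr : ∀ e, τ'.mem.ptr e = τ.mem.ptr (s e)
  valid : ∀ e, e ∈ τ'.valid ↔ s e ∈ τ.valid
  fresh : τ'.fresh = τ.fresh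
  freed : τ'.freed = τ.freed

/-- Pointer variables, and selectors of addresses held by valid pointers. -/
def Accessible (τ : Comp Thread PVar DVar Adr Dom Func) : PExp PVar Adr → Prop
  | .var _ => True
  | .sel b => b ∈ τ.mem.image τ.valid

/-- Every changed expression is accessible, and so is its source. -/
def SafeMove (τ : Comp Thread PVar DVar Adr Dom Func) (s : PExp PVar Adr → PExp PVar Adr) : Prop :=
  ∀ e, s e = e ∨ Accessible τ e ∧ Accessible τ (s e)

theorem Moves.image_subset {τ τ' : Comp Thread PVar DVar Adr Dom Func} {s} (h : Moves τ τ' s) :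
    τ'.mem.image τ'.valid ⊆ τ.mem.image τ.valid := by
  rintro b ⟨e, he, hb⟩
  exact ⟨s e, (h.valid e).1 he, by rw [← h.ptr, hb]⟩

/-- A selector whose validity changes belongs to an address already held by a valid pointer, so no
address becomes valid. -/
theorem Moves.validAdr {τ τ' : Comp Thread PVar DVar Adr Dom Func} {s} (h : Moves τ τ' s) (hs : SafeMove τ s) {b : Adr}
    (hb : ValidAdr τ' b) : ValidAdr τ b := by
  rcases hb with hb | hb
  · exact .inl (h.image_subset hb)
  · rcases hs (.sel b) with he | ⟨ha, -⟩
    · have := (h.valid _).1 hb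
      rw [he] at this
      exact .inr this
    · exact .inl ha

theorem Inv.accessible_def {τ : Comp Thread PVar DVar Adr Dom Func} (hI : Inv τ) {e : PExp PVar Adr} (he : Accessible τ e) :
    τ.mem.ptr e ≠ none := by
  cases e with
  | var p => exact hI.var_def p
  | sel b => exact hI.sel_def b he

theorem Moves.inv {τ τ' : Comp Thread PVar DVar Adr Dom Func} {s} (h : Moves τ τ' s) (hs : SafeMove τ s) (hI : Inv τ)
    (hh : ∀ b ∈ τ'.fresh, b ∈ SMR.histFresh τ'.history) : Inv τ' where
  var_def p := by
    rw [h.ptr]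
    rcases hs (.var p) with he | ⟨-, ha⟩
    · rw [he]; exact hI.var_def p
    · exact hI.accessible_def ha
  sel_def b hb := by
    rw [h.ptr]
    rcases hs (.sel b) with he | ⟨-, ha⟩
    · rw [he]; exact hI.sel_def b (h.image_subset hb)
    · exact hI.accessible_def ha
  valid_def e he := by
    rw [h.ptr]
    exact hI.valid_def _ ((h.valid e).1 he)
  fresh_ne b hb e := by
    rw [h.ptr]
    exact hI.fresh_ne b (h.fresh ▸ hb) _
  not_validAdr b hb hv := by
    rw [h.fresh, h.freed] at hb
    exact hI.not_validAdr b hb (h.validAdr hs hv)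
  histFresh := hh
  seg_valid e he := by
    rw [h.ptr] at he
    exact (h.valid e).2 (hI.seg_valid _ he)

theorem Moves.invOnly {τ τ' : Comp Thread PVar DVar Adr Dom Func} {s} (h : Moves τ τ' s) (hs : SafeMove τ s) {a : Adr}
    (hI : InvOnly a τ) : InvOnly a τ' := by
  intro e c he hv hc hvc
  rw [h.ptr] at he
  rw [h.valid] at hv
  exact hI _ c he hv hc (h.validAdr hs hvc)

theorem inv_nil : Inv (.nil : Comp Thread PVar DVar Adr Dom Func) where
  var_def p := by simp [Comp.mem, Memory.initial]
  sel_def b hb := by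
    obtain ⟨e, -, he⟩ := hb
    cases e <;> simp [Comp.mem, Memory.initial] at he
  valid_def e he := by
    obtain ⟨p, rfl⟩ := he
    simp [Comp.mem, Memory.initial]
  fresh_ne b _ e he := by
    cases e <;> simp [Comp.mem, Memory.initial] at he
  not_validAdr b _ hv := by
    rcases hv with ⟨e, -, he⟩ | hv
    · cases e <;> simp [Comp.mem, Memory.initial] at he
    · simp [Comp.valid] at hv
  histFresh b _ := by simp [SMR.histFresh, Comp.history]
  seg_valid e he := by
    cases e <;> simp [Comp.mem, Memory.initial, Comp.valid] at he ⊢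

theorem invOnly_nil (a : Adr) : InvOnly a (.nil : Comp Thread PVar DVar Adr Dom Func) := by
  intro e c he
  cases e <;> simp [Comp.mem, Memory.initial] at he

/-! ### The effect of single actions -/

/-- The action of an environment free. -/
def freeAction (t : Thread) (a : Adr) : Action Thread PVar DVar Adr Dom Func :=
  ⟨t, .free a, [.ptr (.sel a) none, .dat (.sel a) none]⟩

/-- The action of an allocation. -/
def mallocAction (t : Thread) (p : PVar) (a : Adr) (d : Dom) :
    Action Thread PVar DVar Adr Dom Func :=
  ⟨t, .prog (.malloc p),
    [.ptr (.var p) (some (.adr a)), .ptr (.sel a) (some .seg), .dat (.sel a) (some d)]⟩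

open Classical in
theorem ptr_free (τ : Comp Thread PVar DVar Adr Dom Func) (t : Thread) (a : Adr) (e : PExp PVar Adr) :
    (τ.snoc (freeAction t a)).mem.ptr e = if e = .sel a then none else τ.mem.ptr e := by
  simp [Comp.mem, Memory.apply, Memory.set, freeAction, Function.update_apply]

open Classical in
theorem dat_free (τ : Comp Thread PVar DVar Adr Dom Func) (t : Thread) (a : Adr) (e : DExp DVar Adr) :
    (τ.snoc (freeAction t a)).mem.dat e = if e = .sel a then none else τ.mem.dat e := by
  simp [Comp.mem, Memory.apply, Memory.set, freeAction, Function.update_apply]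

theorem mem_valid_free (τ : Comp Thread PVar DVar Adr Dom Func) (t : Thread) (a : Adr) (e : PExp PVar Adr) :
    e ∈ (τ.snoc (freeAction t a)).valid ↔
      e ∈ τ.valid ∧ τ.mem.ptr e ≠ some (.adr a) ∧ e ≠ .sel a := by
  simp only [Comp.valid, freeAction, Set.mem_sdiff, Set.mem_union, Set.mem_ofPred_eq,
    Set.mem_singleton_iff, not_or, ne_eq]

theorem mem_image_free {τ : Comp Thread PVar DVar Adr Dom Func} {t : Thread} {a b : Adr}
    (hb : b ∈ (τ.snoc (freeAction t a)).mem.image (τ.snoc (freeAction t a)).valid) :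
    b ∈ τ.mem.image τ.valid ∧ b ≠ a := by
  obtain ⟨e, he, hb⟩ := hb
  rw [mem_valid_free] at he
  rw [ptr_free, if_neg he.2.2] at hb
  exact ⟨⟨e, he.1, hb⟩, by rintro rfl; exact he.2.1 hb⟩

theorem validAdr_free {τ : Comp Thread PVar DVar Adr Dom Func} {t : Thread} {a b : Adr}
    (hb : ValidAdr (τ.snoc (freeAction t a)) b) : ValidAdr τ b ∧ b ≠ a := by
  rcases hb with hb | hb
  · exact ⟨.inl (mem_image_free hb).1, (mem_image_free hb).2⟩
  · rw [mem_valid_free] at hb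
    exact ⟨.inr hb.1, by rintro rfl; exact hb.2.2 rfl⟩

theorem Inv.free {τ : Comp Thread PVar DVar Adr Dom Func} (hI : Inv τ) (t : Thread) (a : Adr) :
    Inv (τ.snoc (freeAction t a)) where
  var_def p := by
    rw [ptr_free, if_neg (by simp)]
    exact hI.var_def p
  sel_def b hb := by
    have := mem_image_free hb
    rw [ptr_free, if_neg (by simpa using this.2)]
    exact hI.sel_def b this.1
  valid_def e he := by
    rw [mem_valid_free] at he
    rw [ptr_free, if_neg he.2.2]
    exact hI.valid_def e he.1
  fresh_ne b hb e := by
    have hb : b ∈ τ.fresh := hb.1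
    rw [ptr_free]
    split
    · simp
    · exact hI.fresh_ne b hb e
  not_validAdr b hb hv := by
    have := validAdr_free hv
    refine hI.not_validAdr b ?_ this.1
    simp only [Comp.fresh, Comp.freed, freeAction] at hb
    rcases hb with hb | hb | hb
    · exact .inl hb.1
    · exact .inr hb
    · exact absurd hb this.2
  histFresh b hb := by
    have hb : b ∈ τ.fresh \ {a} := hb
    simp only [Comp.history, freeAction, histFresh_append]
    exact ⟨hI.histFresh b hb.1, mem_histFresh_singleton.2 (by simpa [Event.adrs] using hb.2)⟩
  seg_valid e he := by
    rw [ptr_free] at he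
    split at he
    · simp at he
    · rename_i hne
      rw [mem_valid_free]
      exact ⟨hI.seg_valid e he, by simp [he], hne⟩

theorem InvOnly.free {a : Adr} {τ : Comp Thread PVar DVar Adr Dom Func} (hI : InvOnly a τ) (t : Thread) (a' : Adr) :
    InvOnly a (τ.snoc (freeAction t a')) := by
  intro e c he hv hc hvc
  obtain ⟨hvc, hca⟩ := validAdr_free hvc
  rw [ptr_free] at he
  split at he
  · simp at he
  · rename_i hne
    refine hI e c he (fun h => hv ?_) hc hvc
    rw [mem_valid_free]
    refine ⟨h, ?_, hne⟩
    rw [he]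
    simpa using hca

open Classical in
theorem ptr_malloc (τ : Comp Thread PVar DVar Adr Dom Func) (t : Thread) (p : PVar) (a : Adr) (d : Dom) (e : PExp PVar Adr) :
    (τ.snoc (mallocAction t p a d)).mem.ptr e =
      if e = .sel a then some .seg else if e = .var p then some (.adr a) else τ.mem.ptr e := by
  simp [Comp.mem, Memory.apply, Memory.set, mallocAction, Function.update_apply]

open Classical in
theorem dat_malloc (τ : Comp Thread PVar DVar Adr Dom Func) (t : Thread) (p : PVar) (a : Adr) (d : Dom) (e : DExp DVar Adr) :
    (τ.snoc (mallocAction t p a d)).mem.dat e = if e = .sel a then some d else τ.mem.dat e := by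
  simp [Comp.mem, Memory.apply, Memory.set, mallocAction, Function.update_apply]

theorem adrOf_malloc (τ : Comp Thread PVar DVar Adr Dom Func) (t : Thread) (p : PVar) (a : Adr) (d : Dom) :
    (τ.snoc (mallocAction t p a d)).mem.adrOf p = some a := by
  rw [Memory.adrOf_eq_some, ptr_malloc]
  simp

theorem mem_valid_malloc (τ : Comp Thread PVar DVar Adr Dom Func) (t : Thread) (p : PVar) (a : Adr) (d : Dom)
    (e : PExp PVar Adr) :
    e ∈ (τ.snoc (mallocAction t p a d)).valid ↔ e ∈ τ.valid ∨ e = .var p ∨ e = .sel a := by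
  have h := adrOf_malloc τ t p a d
  unfold mallocAction at h ⊢
  simp only [Comp.valid]
  rw [h]
  simp only [Set.mem_union, Set.mem_insert_iff, Set.mem_singleton_iff]

theorem fresh_malloc (τ : Comp Thread PVar DVar Adr Dom Func) (t : Thread) (p : PVar) (a : Adr) (d : Dom) :
    (τ.snoc (mallocAction t p a d)).fresh = τ.fresh \ {a} := by
  have h := adrOf_malloc τ t p a d
  unfold mallocAction at h ⊢
  simp only [Comp.fresh]
  rw [h]
  simp

theorem freed_malloc (τ : Comp Thread PVar DVar Adr Dom Func) (t : Thread) (p : PVar) (a : Adr) (d : Dom) :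
    (τ.snoc (mallocAction t p a d)).freed = τ.freed \ {a} := by
  have h := adrOf_malloc τ t p a d
  unfold mallocAction at h ⊢
  simp only [Comp.freed]
  rw [h]
  simp

theorem history_malloc (τ : Comp Thread PVar DVar Adr Dom Func) (t : Thread) (p : PVar) (a : Adr) (d : Dom) :
    (τ.snoc (mallocAction t p a d)).history = τ.history := rfl

theorem mem_image_malloc {τ : Comp Thread PVar DVar Adr Dom Func} {t : Thread} {p : PVar} {a b : Adr} {d : Dom}
    (hb : b ∈ (τ.snoc (mallocAction t p a d)).mem.image (τ.snoc (mallocAction t p a d)).valid) :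
    b ∈ τ.mem.image τ.valid ∨ b = a := by
  obtain ⟨e, he, hb⟩ := hb
  rw [mem_valid_malloc] at he
  rw [ptr_malloc] at hb
  split at hb
  · simp at hb
  · split at hb
    · simp only [Option.some.injEq, PVal.adr.injEq] at hb
      exact .inr hb.symm
    · exact .inl ⟨e, by tauto, hb⟩

theorem validAdr_malloc {τ : Comp Thread PVar DVar Adr Dom Func} {t : Thread} {p : PVar} {a b : Adr} {d : Dom}
    (hb : ValidAdr (τ.snoc (mallocAction t p a d)) b) : ValidAdr τ b ∨ b = a := by
  rcases hb with hb | hb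
  · exact (mem_image_malloc hb).imp .inl id
  · rw [mem_valid_malloc] at hb
    rcases hb with hb | hb | hb
    · exact .inl (.inr hb)
    · simp at hb
    · exact .inr (by simpa using hb)

theorem Inv.malloc {τ : Comp Thread PVar DVar Adr Dom Func} (hI : Inv τ) (t : Thread) (p : PVar) (a : Adr) (d : Dom) :
    Inv (τ.snoc (mallocAction t p a d)) where
  var_def q := by
    rw [ptr_malloc, if_neg (by simp)]
    split
    · simp
    · exact hI.var_def q
  sel_def b hb := by
    rw [ptr_malloc]
    split
    · simp
    · rename_i hne
      rcases mem_image_malloc hb with hb | rfl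
      · simpa using hI.sel_def b hb
      · exact absurd rfl hne
  valid_def e he := by
    rw [mem_valid_malloc] at he
    rw [ptr_malloc]
    split
    · simp
    · split
      · simp
      · exact hI.valid_def e (by tauto)
  fresh_ne b hb e := by
    rw [fresh_malloc] at hb
    rw [ptr_malloc]
    split
    · simp
    · split
      · simpa [eq_comm] using hb.2
      · exact hI.fresh_ne b hb.1 e
  not_validAdr b hb hv := by
    rw [fresh_malloc, freed_malloc] at hb
    rcases validAdr_malloc hv with hv | rfl
    · exact hI.not_validAdr b (hb.imp And.left And.left) hv
    · rcases hb with hb | hb <;> exact hb.2 rfl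
  histFresh b hb := by
    rw [fresh_malloc] at hb
    exact hI.histFresh b hb.1
  seg_valid e he := by
    rw [ptr_malloc] at he
    rw [mem_valid_malloc]
    split at he
    · tauto
    · split at he
      · tauto
      · exact .inl (hI.seg_valid e he)

/-- A stale pointer can see its address become valid only through a reallocation. A fresh address is
held by no pointer, and the only reusable address is the exempt `a`. -/
theorem InvOnly.malloc {a : Adr} {τ : Comp Thread PVar DVar Adr Dom Func} (hI : InvOnly a τ) (hJ : Inv τ) (t : Thread) (p : PVar)
    {b : Adr} (hb : b ∈ τ.fresh ∨ b ∈ τ.freed ∩ {a}) (d : Dom) :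
    InvOnly a (τ.snoc (mallocAction t p b d)) := by
  intro e c he hv hc hvc
  rw [mem_valid_malloc] at hv
  rw [ptr_malloc, if_neg (by tauto), if_neg (by tauto)] at he
  rcases validAdr_malloc hvc with hvc | rfl
  · exact hI e c he (by tauto) hc hvc
  · rcases hb with hb | hb
    · exact hJ.fresh_ne c hb e he
    · exact hc hb.2

end Invariants

/-! ### Commands as pointer moves, and preservation of the invariants. -/

section Steps

variable {Thread PVar DVar Adr Dom Func Loc OLoc OVar : Type*} [Zero Dom]

open Classical in
theorem moves_assign (τ : Comp Thread PVar DVar Adr Dom Func) (t : Thread) (p q : PVar) :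
    Moves τ (τ.snoc ⟨t, .prog (.assign p q), [.ptr (.var p) (τ.mem.ptr (.var q))]⟩)
      (fun e => if e = .var p then .var q else e) where
  ptr e := by
    simp only [Comp.mem, Memory.apply, Memory.set, List.foldl, Function.update_apply]
    split <;> rfl
  valid e := by
    simp only [Comp.valid]
    split <;> split <;> simp_all
  fresh := rfl
  freed := rfl

open Classical in
theorem moves_store (τ : Comp Thread PVar DVar Adr Dom Func) (t : Thread) (p q : PVar) {a : Adr}
    (hp : τ.mem.ptr (.var p) = some (.adr a)) :
    Moves τ (τ.snoc ⟨t, .prog (.store p q), [.ptr (.sel a) (τ.mem.ptr (.var q))]⟩)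
      (fun e => if e = .sel a then .var q else e) where
  ptr e := by
    simp only [Comp.mem, Memory.apply, Memory.set, List.foldl, Function.update_apply]
    split <;> rfl
  valid e := by
    simp only [Comp.valid, Memory.adrOf_eq_some.2 hp]
    split <;> split <;> simp_all
  fresh := rfl
  freed := rfl

open Classical in
theorem moves_load (τ : Comp Thread PVar DVar Adr Dom Func) (t : Thread) (p q : PVar) {a : Adr}
    (hq : τ.mem.ptr (.var q) = some (.adr a)) :
    Moves τ (τ.snoc ⟨t, .prog (.load p q), [.ptr (.var p) (τ.mem.ptr (.sel a))]⟩)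
      (fun e => if e = .var p then .sel a else e) where
  ptr e := by
    simp only [Comp.mem, Memory.apply, Memory.set, List.foldl, Function.update_apply]
    split <;> rfl
  valid e := by
    simp only [Comp.valid, Memory.adrOf_eq_some.2 hq]
    split <;> split <;> simp_all
  fresh := rfl
  freed := rfl

open Classical in
-- As the two values are equal, the assertion acts like an assignment from the valid variable:
-- memory is unchanged and only validity is copied.
theorem moves_assert_peq_left (τ : Comp Thread PVar DVar Adr Dom Func) (t : Thread) (p q : PVar)
    (hpq : τ.mem.ptr (.var p) = τ.mem.ptr (.var q)) (hp : PExp.var p ∈ τ.valid) :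
    Moves τ (τ.snoc ⟨t, .prog (.assert (.peq p q)), []⟩)
      (fun e => if e = .var q then .var p else e) where
  ptr e := by
    simp only [Comp.mem, Memory.apply, List.foldl]
    split <;> simp_all
  valid e := by
    simp only [Comp.valid]
    split <;> split <;> simp_all
  fresh := rfl
  freed := rfl

open Classical in
theorem moves_assert_peq_right (τ : Comp Thread PVar DVar Adr Dom Func) (t : Thread) (p q : PVar)
    (hpq : τ.mem.ptr (.var p) = τ.mem.ptr (.var q)) (hq : PExp.var q ∈ τ.valid) :
    Moves τ (τ.snoc ⟨t, .prog (.assert (.peq p q)), []⟩)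
      (fun e => if e = .var p then .var q else e) where
  ptr e := by
    simp only [Comp.mem, Memory.apply, List.foldl]
    split <;> simp_all
  valid e := by
    simp only [Comp.valid]
    split <;> split <;> simp_all
  fresh := rfl
  freed := rfl

theorem moves_assert_peq_of_invalid (τ : Comp Thread PVar DVar Adr Dom Func) (t : Thread)
    (p q : PVar) (hp : PExp.var p ∉ τ.valid) (hq : PExp.var q ∉ τ.valid) :
    Moves τ (τ.snoc ⟨t, .prog (.assert (.peq p q)), []⟩) id where
  ptr e := rfl
  valid e := by simp [Comp.valid, hp, hq]
  fresh := rfl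
  freed := rfl

theorem moves_id {τ τ' : Comp Thread PVar DVar Adr Dom Func} (hp : τ'.mem.ptr = τ.mem.ptr)
    (hv : τ'.valid = τ.valid) (hf : τ'.fresh = τ.fresh) (hf' : τ'.freed = τ.freed) :
    Moves τ τ' id where
  ptr e := by rw [hp]; rfl
  valid e := by rw [hv]; rfl
  fresh := hf
  freed := hf'

theorem safeMove_id (τ : Comp Thread PVar DVar Adr Dom Func) : SafeMove τ id := fun _ => .inl rfl

open Classical in
theorem safeMove_ite {τ : Comp Thread PVar DVar Adr Dom Func} {e₁ e₂ : PExp PVar Adr}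
    (h₁ : Accessible τ e₁) (h₂ : Accessible τ e₂) :
    SafeMove τ (fun e => if e = e₁ then e₂ else e) := by
  intro e
  by_cases he : e = e₁
  · subst he
    exact .inr ⟨h₁, by simpa using h₂⟩
  · exact .inl (by simp [he])

variable [LT Dom]

/-- A command which does not allocate moves pointers in the same way in two computations with the
same valid pointers. -/
theorem exists_common_moves {τ σ : Comp Thread PVar DVar Adr Dom Func} {X Y : Set Adr}
    {c : Com PVar DVar Dom Func} {up up' : List (Upd PVar DVar Adr Dom)} (t : Thread)
    (hV : τ.valid = σ.valid) (hp : ∀ e ∈ τ.valid, τ.mem.ptr e = σ.mem.ptr e)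
    (hc : Enabled τ X c up) (hc' : Enabled σ Y c up')
    (hs : ∀ p ∈ c.derefs, PExp.var p ∈ τ.valid) (hm : ∀ p, c ≠ .malloc p) :
    ∃ s, Moves τ (τ.snoc ⟨t, .prog c, up⟩) s ∧ Moves σ (σ.snoc ⟨t, .prog c, up'⟩) s ∧
      SafeMove τ s := by
  have hacc : ∀ {p a}, p ∈ c.derefs → τ.mem.ptr (.var p) = some (.adr a) →
      a ∈ τ.mem.image τ.valid := fun {p a} h h' => ⟨.var p, hs p h, h'⟩
  cases hc with
  | malloc p => exact absurd rfl (hm p)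
  | assign p q =>
    cases hc'
    exact ⟨_, moves_assign τ t p q, moves_assign σ t p q, safeMove_ite trivial trivial⟩
  | store p q a ha =>
    cases hc' with | store _ _ a' ha' =>
    -- The dereferenced variable is valid, so both computations access the same selector.
    have : a' = a := by simpa [hp _ (hs p rfl), ha'] using ha
    subst this
    exact ⟨_, moves_store τ t p q ha, moves_store σ t p q ha',
      safeMove_ite (hacc (p := p) rfl ha) trivial⟩
  | load p q a ha =>
    cases hc' with | load _ _ a' ha' =>
    have : a' = a := by simpa [hp _ (hs q rfl), ha'] using ha
    subst this
    exact ⟨_, moves_load τ t p q ha, moves_load σ t p q ha',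
      safeMove_ite trivial (hacc (p := q) rfl ha)⟩
  | assert c hc =>
    cases hc' with | assert _ hc' =>
    cases c with
    | peq p q =>
      by_cases hpv : PExp.var p ∈ τ.valid
      · exact ⟨_, moves_assert_peq_left τ t p q hc hpv,
          moves_assert_peq_left σ t p q hc' (hV ▸ hpv), safeMove_ite trivial trivial⟩
      by_cases hqv : PExp.var q ∈ τ.valid
      · exact ⟨_, moves_assert_peq_right τ t p q hc hqv,
          moves_assert_peq_right σ t p q hc' (hV ▸ hqv), safeMove_ite trivial trivial⟩
      exact ⟨_, moves_assert_peq_of_invalid τ t p q hpv hqv,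
        moves_assert_peq_of_invalid σ t p q (hV ▸ hpv) (hV ▸ hqv), safeMove_id τ⟩
    | _ => exact ⟨id, moves_id rfl rfl rfl rfl, moves_id rfl rfl rfl rfl, safeMove_id τ⟩
  | _ =>
    cases hc'
    exact ⟨id, moves_id rfl rfl rfl rfl, moves_id rfl rfl rfl rfl, safeMove_id τ⟩

omit [LT Dom] in
-- No pointer holds a fresh address, so no call can pass one.
theorem fresh_subset_histFresh_prog {τ : Comp Thread PVar DVar Adr Dom Func} (hI : Inv τ)
    (t : Thread) (c : Com PVar DVar Dom Func) (up : List (Upd PVar DVar Adr Dom)) {b : Adr}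
    (hb : b ∈ τ.fresh) : b ∈ histFresh (τ.snoc ⟨t, .prog c, up⟩).history := by
  have h := hI.histFresh b hb
  cases c with
  | enter f ps xs =>
    simp only [Comp.history, histFresh_append]
    refine ⟨h, mem_histFresh_singleton.2 fun hmem => ?_⟩
    obtain ⟨p, -, hp⟩ := List.mem_filterMap.1 hmem
    exact hI.fresh_ne b hb _ (Memory.adrOf_eq_some.1 hp)
  | exit =>
    simp only [Comp.history, histFresh_append]
    exact ⟨h, mem_histFresh_singleton.2 (by simp [Event.adrs])⟩
  | _ => exact h

theorem Inv.prog {τ : Comp Thread PVar DVar Adr Dom Func} (hI : Inv τ) {X : Set Adr} (t : Thread)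
    {c : Com PVar DVar Dom Func} {up : List (Upd PVar DVar Adr Dom)} (hc : Enabled τ X c up)
    (hs : ∀ p ∈ c.derefs, PExp.var p ∈ τ.valid) : Inv (τ.snoc ⟨t, .prog c, up⟩) := by
  by_cases hm : ∃ p, c = .malloc p
  · obtain ⟨p, rfl⟩ := hm
    cases hc with | malloc _ a d ha => exact hI.malloc t p a d
  · push Not at hm
    -- Comparing the computation with itself yields its own move.
    obtain ⟨s, hmv, -, hsm⟩ := exists_common_moves t rfl (fun _ _ => rfl) hc hc hs hm
    exact hmv.inv hsm hI fun b hb => fresh_subset_histFresh_prog hI t c up (hmv.fresh ▸ hb)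

theorem InvOnly.prog {τ : Comp Thread PVar DVar Adr Dom Func} {a : Adr} (hJ : InvOnly a τ)
    (hI : Inv τ) (t : Thread)
    {c : Com PVar DVar Dom Func} {up : List (Upd PVar DVar Adr Dom)} (hc : Enabled τ {a} c up)
    (hs : ∀ p ∈ c.derefs, PExp.var p ∈ τ.valid) : InvOnly a (τ.snoc ⟨t, .prog c, up⟩) := by
  by_cases hm : ∃ p, c = .malloc p
  · obtain ⟨p, rfl⟩ := hm
    cases hc with | malloc _ b d hb => exact hJ.malloc hI t p hb d
  · push Not at hm
    obtain ⟨s, hmv, -, hsm⟩ := exists_common_moves t rfl (fun _ _ => rfl) hc hc hs hm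
    exact hmv.invOnly hsm hJ

theorem PointerRaceFree.safe {D : Program Thread PVar DVar Dom Func Loc}
    {O : Observer Func OLoc OVar} (hrace : PointerRaceFree Adr D O) {a : Adr}
    {τ : Comp Thread PVar DVar Adr Dom Func} {t : Thread} {c : Com PVar DVar Dom Func}
    {up : List (Upd PVar DVar Adr Dom)} (h : Sem D O {a} (τ.snoc ⟨t, .prog c, up⟩)) :
    ∀ p ∈ c.derefs, PExp.var p ∈ τ.valid := by
  intro p hp
  by_contra hv
  exact hrace a τ _ h (.inl ⟨c, rfl, p, hp, hv⟩)

theorem Sem.inv {D : Program Thread PVar DVar Dom Func Loc} {O : Observer Func OLoc OVar}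
    (hrace : PointerRaceFree Adr D O) {a : Adr} {τ : Comp Thread PVar DVar Adr Dom Func}
    (h : Sem D O {a} τ) : Inv τ ∧ InvOnly a τ := by
  induction h with
  | nil => exact ⟨inv_nil, invOnly_nil a⟩
  | prog t c up hτ hctrl hc ih =>
    have hs := hrace.safe (.prog t c up hτ hctrl hc)
    exact ⟨ih.1.prog t hc hs, ih.2.prog ih.1 t hc hs⟩
  | free t b hτ hb ih => exact ⟨ih.1.free t b, ih.2.free t b⟩

/-- Each action uses up at most one fresh address. -/
theorem finite_compl_fresh {D : Program Thread PVar DVar Dom Func Loc}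
    {O : Observer Func OLoc OVar} {X : Set Adr} {τ : Comp Thread PVar DVar Adr Dom Func}
    (h : Sem D O X τ) : (τ.fresh)ᶜ.Finite := by
  induction h with
  | nil => simp [Comp.fresh]
  | prog t c up hτ hctrl hc ih =>
    cases hc with
    | malloc p a d ha =>
      refine (ih.union (Set.finite_singleton a)).subset ?_
      have := fresh_malloc (Func := Func) (DVar := DVar) ‹_› t p a d
      unfold mallocAction at this
      rw [this]
      intro x hx
      simp at hx ⊢; tauto
    | _ => exact ih
  | @free τ t b hτ hb ih =>
    refine (ih.union (Set.finite_singleton b)).subset ?_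
    intro x hx
    simp [Comp.fresh] at hx ⊢; tauto

end Steps

/-! ### Address permutations of computations -/

section Permutations

variable {Thread PVar DVar Adr Dom Func Loc OLoc OVar : Type*}

/-- Apply a permutation of the addresses to a pointer value. -/
def PVal.perm (π : Equiv.Perm Adr) : PVal Adr → PVal Adr
  | seg => seg
  | adr a => adr (π a)

/-- Apply a permutation of the addresses to a pointer expression. -/
def PExp.perm (π : Equiv.Perm Adr) : PExp PVar Adr → PExp PVar Adr
  | var p => var p
  | sel a => sel (π a)

/-- Apply a permutation of the addresses to a data expression. -/
def DExp.perm (π : Equiv.Perm Adr) : DExp DVar Adr → DExp DVar Adr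
  | var x => var x
  | sel a => sel (π a)

/-- Apply a permutation of the addresses to an update. -/
def Upd.perm (π : Equiv.Perm Adr) : Upd PVar DVar Adr Dom → Upd PVar DVar Adr Dom
  | ptr e v => ptr (e.perm π) (v.map (PVal.perm π))
  | dat e v => dat (e.perm π) v

/-- Apply a permutation of the addresses to the command of an action. -/
def Cmd.perm (π : Equiv.Perm Adr) : Cmd PVar DVar Adr Dom Func → Cmd PVar DVar Adr Dom Func
  | prog c => prog c
  | free a => free (π a)

/-- Apply a permutation of the addresses to an action. -/
def Action.perm (π : Equiv.Perm Adr) (act : Action Thread PVar DVar Adr Dom Func) :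
    Action Thread PVar DVar Adr Dom Func :=
  ⟨act.thread, act.cmd.perm π, act.up.map (Upd.perm π)⟩

/-- Apply a permutation of the addresses to a computation. -/
def Comp.perm (π : Equiv.Perm Adr) :
    Comp Thread PVar DVar Adr Dom Func → Comp Thread PVar DVar Adr Dom Func
  | nil => nil
  | snoc τ act => snoc (τ.perm π) (act.perm π)

variable (π : Equiv.Perm Adr)

@[simp] theorem PVal.perm_adr (a : Adr) : (PVal.adr a).perm π = .adr (π a) := rfl

@[simp] theorem PExp.perm_var (p : PVar) : (PExp.var p : PExp PVar Adr).perm π = .var p := rfl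

@[simp] theorem PExp.perm_sel (a : Adr) : (PExp.sel a : PExp PVar Adr).perm π = .sel (π a) := rfl

@[simp] theorem DExp.perm_var (x : DVar) : (DExp.var x : DExp DVar Adr).perm π = .var x := rfl

@[simp] theorem DExp.perm_sel (a : Adr) : (DExp.sel a : DExp DVar Adr).perm π = .sel (π a) := rfl

theorem PVal.perm_injective : Function.Injective (PVal.perm π) := by
  intro v w h
  cases v <;> cases w <;> simp_all [PVal.perm]

theorem PExp.perm_injective : Function.Injective (PExp.perm (PVar := PVar) π) := by
  intro v w h
  cases v <;> cases w <;> simp_all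

theorem DExp.perm_injective : Function.Injective (DExp.perm (DVar := DVar) π) := by
  intro v w h
  cases v <;> cases w <;> simp_all

variable {π} in
@[simp] theorem map_perm_eq_some_adr {v : Option (PVal Adr)} {a : Adr} :
    v.map (PVal.perm π) = some (.adr (π a)) ↔ v = some (.adr a) := by
  rw [← PVal.perm_adr, ← Option.map_some, (Option.map_injective (PVal.perm_injective π)).eq_iff]

/-- The memory `m'` is obtained from `m` by applying the permutation `π` to the addresses. -/
structure Memory.IsPerm (m m' : Memory PVar DVar Adr Dom) : Prop where
  ptr : ∀ e, m'.ptr (PExp.perm π e) = (m.ptr e).map (PVal.perm π)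
  dat : ∀ e, m'.dat (DExp.perm π e) = m.dat e

variable {π}

theorem Memory.IsPerm.set {m m' : Memory PVar DVar Adr Dom} (h : m.IsPerm π m')
    (u : Upd PVar DVar Adr Dom) : (m.set u).IsPerm π (m'.set (u.perm π)) := by
  classical
  cases u with
  | ptr e v =>
    refine ⟨fun e' => ?_, h.dat⟩
    simp only [Memory.set, Upd.perm, Function.update_apply, (PExp.perm_injective π).eq_iff]
    split
    · rfl
    · exact h.ptr e'
  | dat e v =>
    refine ⟨h.ptr, fun e' => ?_⟩
    simp only [Memory.set, Upd.perm, Function.update_apply, (DExp.perm_injective π).eq_iff]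
    split
    · rfl
    · exact h.dat e'

theorem Memory.IsPerm.apply {m m' : Memory PVar DVar Adr Dom} (h : m.IsPerm π m')
    (up : List (Upd PVar DVar Adr Dom)) :
    (m.apply up).IsPerm π (m'.apply (up.map (Upd.perm π))) := by
  induction up generalizing m m' with
  | nil => exact h
  | cons u up ih => exact ih (h.set u)

theorem Memory.IsPerm.ptr_var {m m' : Memory PVar DVar Adr Dom} (h : m.IsPerm π m') (p : PVar) :
    m'.ptr (.var p) = (m.ptr (.var p)).map (PVal.perm π) := h.ptr (.var p)

theorem Memory.IsPerm.ptr_sel {m m' : Memory PVar DVar Adr Dom} (h : m.IsPerm π m') (a : Adr) :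
    m'.ptr (.sel (π a)) = (m.ptr (.sel a)).map (PVal.perm π) := h.ptr (.sel a)

theorem Memory.IsPerm.dat_var {m m' : Memory PVar DVar Adr Dom} (h : m.IsPerm π m') (x : DVar) :
    m'.dat (.var x) = m.dat (.var x) := h.dat (.var x)

theorem Memory.IsPerm.adrOf {m m' : Memory PVar DVar Adr Dom} (h : m.IsPerm π m') (p : PVar) :
    m'.adrOf p = (m.adrOf p).map π := by
  unfold Memory.adrOf
  rw [h.ptr_var]
  rcases m.ptr (.var p) with _ | _ | _ <;> rfl

variable [Zero Dom]

theorem mem_isPerm (τ : Comp Thread PVar DVar Adr Dom Func) :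
    τ.mem.IsPerm π (τ.perm π).mem := by
  induction τ with
  | nil => constructor <;> rintro (_ | _) <;> rfl
  | snoc τ act ih => exact ih.apply act.up

theorem adrOf_perm_eq_some (τ : Comp Thread PVar DVar Adr Dom Func) (p : PVar) (b : Adr) :
    (τ.perm π).mem.adrOf p = some (π b) ↔ τ.mem.adrOf p = some b := by
  rw [(mem_isPerm τ).adrOf, ← Option.map_some, (Option.map_injective π.injective).eq_iff]

theorem mem_fresh_perm (τ : Comp Thread PVar DVar Adr Dom Func) (b : Adr) :
    π b ∈ (τ.perm π).fresh ↔ b ∈ τ.fresh := by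
  induction τ with
  | nil => simp [Comp.perm, Comp.fresh]
  | snoc τ act ih =>
    have h := adrOf_perm_eq_some (π := π) (τ.snoc act)
    obtain ⟨t, c, up⟩ := act
    cases c with
    | free a => simp [Comp.perm, Action.perm, Cmd.perm, Comp.fresh, ih]
    | prog c =>
      cases c with
      | malloc p =>
        simp only [Comp.perm, Action.perm, Cmd.perm] at h
        simp [Comp.perm, Action.perm, Cmd.perm, Comp.fresh, ih, h]
      | _ => exact ih

theorem mem_freed_perm (τ : Comp Thread PVar DVar Adr Dom Func) (b : Adr) :
    π b ∈ (τ.perm π).freed ↔ b ∈ τ.freed := by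
  induction τ with
  | nil => simp [Comp.perm, Comp.freed]
  | snoc τ act ih =>
    have h := adrOf_perm_eq_some (π := π) (τ.snoc act)
    obtain ⟨t, c, up⟩ := act
    cases c with
    | free a => simp [Comp.perm, Action.perm, Cmd.perm, Comp.freed, ih]
    | prog c =>
      cases c with
      | malloc p =>
        simp only [Comp.perm, Action.perm, Cmd.perm] at h
        simp [Comp.perm, Action.perm, Cmd.perm, Comp.freed, ih, h]
      | _ => exact ih

theorem history_perm (τ : Comp Thread PVar DVar Adr Dom Func) :
    (τ.perm π).history = τ.history.map (Event.perm π) := by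
  induction τ with
  | nil => rfl
  | snoc τ act ih =>
    obtain ⟨t, c, up⟩ := act
    cases c with
    | free a => simp [Comp.perm, Action.perm, Cmd.perm, Comp.history, ih, Event.perm]
    | prog c =>
      cases c with
      | enter f ps xs =>
        have h := funext (mem_isPerm (π := π) τ).adrOf
        simp only [Comp.perm, Action.perm, Cmd.perm, Comp.history, ih, Event.perm, List.map_append,
          List.map_cons, List.map_nil, List.map_filterMap, (mem_isPerm τ).dat_var, h]
      | exit => simp [Comp.perm, Action.perm, Cmd.perm, Comp.history, ih, Event.perm]
      | _ => exact ih

omit [Zero Dom] in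
theorem ctrl_perm (D : Program Thread PVar DVar Dom Func Loc)
    (τ : Comp Thread PVar DVar Adr Dom Func) : (τ.perm π).ctrl D = τ.ctrl D := by
  induction τ with
  | nil => rfl
  | snoc τ act ih =>
    obtain ⟨t, c, up⟩ := act
    cases c with
    | free a => exact ih
    | prog c => simp only [Comp.perm, Action.perm, Cmd.perm, Comp.ctrl, ih]

theorem mem_valid_perm (τ : Comp Thread PVar DVar Adr Dom Func) (e : PExp PVar Adr) :
    e.perm π ∈ (τ.perm π).valid ↔ e ∈ τ.valid := by
  induction τ generalizing e with
  | nil => cases e <;> simp [Comp.perm, Comp.valid]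
  | snoc τ act ih =>
    have hv : ∀ p, PExp.var p ∈ (τ.perm π).valid ↔ PExp.var p ∈ τ.valid := fun p => ih (.var p)
    have hs : ∀ a, PExp.sel (π a) ∈ (τ.perm π).valid ↔ PExp.sel a ∈ τ.valid :=
      fun a => ih (.sel a)
    have he : ∀ e e' : PExp PVar Adr, e.perm π = e'.perm π ↔ e = e' :=
      fun e e' => (PExp.perm_injective π).eq_iff
    have hev : ∀ (e : PExp PVar Adr) p, e.perm π = .var p ↔ e = .var p := fun e p => he e (.var p)
    have hes : ∀ (e : PExp PVar Adr) a, e.perm π = .sel (π a) ↔ e = .sel a :=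
      fun e a => he e (.sel a)
    have hadr := (mem_isPerm (π := π) τ).adrOf
    have hadr' := (mem_isPerm (π := π) (τ.snoc act)).adrOf
    have hp := (mem_isPerm (π := π) τ).ptr
    obtain ⟨t, c, up⟩ := act
    cases c with
    | free a =>
      simp only [Comp.perm, Action.perm, Cmd.perm, Comp.valid, Set.mem_sdiff, Set.mem_union,
        Set.mem_ofPred_eq, Set.mem_singleton_iff, ih, hes, hp, map_perm_eq_some_adr]
    | prog c =>
      cases c with
      | assign p q =>
        simp only [Comp.perm, Action.perm, Cmd.perm, Comp.valid]
        split <;> rename_i hc <;> rw [hv] at hc <;> simp [ih, hev, hc]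
      | store p q =>
        simp only [Comp.perm, Action.perm, Cmd.perm, Comp.valid, hadr]
        cases τ.mem.adrOf p with
        | none => exact ih e
        | some a =>
          simp only [Option.map_some]
          split <;> rename_i hc <;> rw [hv] at hc <;> simp [ih, hes, hc]
      | load p q =>
        simp only [Comp.perm, Action.perm, Cmd.perm, Comp.valid, hadr]
        cases τ.mem.adrOf q with
        | none => exact ih e
        | some a =>
          simp only [Option.map_some, hs]
          split <;> rename_i hc <;> rw [hs] at hc <;> simp [ih, hev, hc]
      | malloc p =>
        simp only [Comp.perm, Action.perm, Cmd.perm] at hadr'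
        simp only [Comp.perm, Action.perm, Cmd.perm, Comp.valid, hadr']
        cases (τ.snoc ⟨t, .prog (.malloc p), up⟩).mem.adrOf p with
        | none => exact ih e
        | some a => simp [ih, hes, hev]
      | assert c =>
        cases c with
        | peq p q =>
          simp only [Comp.perm, Action.perm, Cmd.perm, Comp.valid]
          split <;> rename_i hc <;> rw [hv, hv] at hc <;> simp [ih, hev, hc]
        | _ => exact ih e
      | _ => exact ih e

variable [LT Dom]

omit [Zero Dom] in
theorem Cond.holds_of_isPerm {m m' : Memory PVar DVar Adr Dom} (h : m.IsPerm π m')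
    {c : Cond PVar DVar} (hc : c.Holds m) : c.Holds m' := by
  cases c with
  | peq p q => simpa only [Cond.Holds, h.ptr_var, h.dat_var] using congrArg _ hc
  | pne p q =>
    simpa only [Cond.Holds, h.ptr_var, ne_eq,
      (Option.map_injective (PVal.perm_injective π)).eq_iff] using hc
  | _ => simpa only [Cond.Holds, h.dat_var] using hc

theorem Enabled.perm {τ : Comp Thread PVar DVar Adr Dom Func} {X : Set Adr}
    (hX : ∀ b ∈ X, π b ∈ X) {c : Com PVar DVar Dom Func} {up : List (Upd PVar DVar Adr Dom)}
    (hc : Enabled τ X c up) : Enabled (τ.perm π) X c (up.map (Upd.perm π)) := by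
  have hm := mem_isPerm (π := π) τ
  have hadr : ∀ {p a}, τ.mem.ptr (.var p) = some (.adr a) →
      (τ.perm π).mem.ptr (.var p) = some (.adr (π a)) := by
    intro p a h
    rw [hm.ptr_var, h]
    rfl
  cases hc with
  | malloc p a d ha =>
    refine .malloc p (π a) d (ha.imp (mem_fresh_perm τ a).2 fun h => ?_)
    exact ⟨(mem_freed_perm τ a).2 h.1, hX a h.2⟩
  | enter f ps xs hps hxs =>
    refine .enter f ps xs (fun p hp => ?_) (by simpa only [hm.dat_var] using hxs)
    obtain ⟨a, ha⟩ := hps p hp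
    exact ⟨π a, hadr ha⟩
  | exit => exact .exit
  | assign p q => simpa [Upd.perm, hm.ptr_var] using Enabled.assign (τ := τ.perm π) (X := X) p q
  | store p q a hp =>
    simpa [Upd.perm, hm.ptr_var] using Enabled.store (X := X) p q (π a) (hadr hp)
  | load p q a hq =>
    simpa [Upd.perm, hm.ptr_sel] using Enabled.load (X := X) p q (π a) (hadr hq)
  | op x f ys ds hys => exact .op x f ys ds (by simpa only [hm.dat_var] using hys)
  | storeData p y a hp =>
    simpa [Upd.perm, hm.dat_var] using Enabled.storeData (X := X) p y (π a) (hadr hp)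
  | loadData x q a hq =>
    have := hm.dat (.sel a)
    rw [DExp.perm_sel] at this
    simpa [Upd.perm, this] using Enabled.loadData (X := X) x q (π a) (hadr hq)
  | assert c hc => exact .assert c (Cond.holds_of_isPerm hm hc)

/-- The semantics treats all addresses alike, apart from the set `X` of reusable ones. For `X = {a}`
this covers every permutation that fixes `a`. -/
theorem Sem.perm {D : Program Thread PVar DVar Dom Func Loc} {O : Observer Func OLoc OVar}
    {X : Set Adr} (hX : ∀ b ∈ X, π b ∈ X) {τ : Comp Thread PVar DVar Adr Dom Func}
    (h : Sem D O X τ) : Sem D O X (τ.perm π) := by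
  induction h with
  | nil => exact .nil
  | prog t c up hτ hctrl hc ih =>
    exact .prog t c _ ih (by rwa [ctrl_perm]) (hc.perm hX)
  | free t a hτ ha ih =>
    refine .free t (π a) ih ?_
    simpa [history_perm, Event.perm] using O.map_perm_mem_spec π ha

end Permutations

/-! ### The relation maintained between computations -/

section Relation

variable {Thread PVar DVar Adr Dom Func Loc OLoc OVar : Type*} [Zero Dom]

/-- Agreement of the valid memories. -/
structure MemAgree (τ σ : Comp Thread PVar DVar Adr Dom Func) : Prop where
  valid : τ.valid = σ.valid
  ptr : ∀ e ∈ τ.valid, τ.mem.ptr e = σ.mem.ptr e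
  dat_var : ∀ x, τ.mem.dat (.var x) = σ.mem.dat (.var x)
  dat_sel : ∀ b ∈ τ.mem.image τ.valid, τ.mem.dat (.sel b) = σ.mem.dat (.sel b)

theorem image_eq_of_agree {τ σ : Comp Thread PVar DVar Adr Dom Func} (hv : τ.valid = σ.valid)
    (hp : ∀ e ∈ τ.valid, τ.mem.ptr e = σ.mem.ptr e) :
    τ.mem.image τ.valid = σ.mem.image σ.valid := by
  ext b
  constructor
  · rintro ⟨e, he, hb⟩
    exact ⟨e, hv ▸ he, by rw [← hp e he, hb]⟩
  · rintro ⟨e, he, hb⟩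
    rw [← hv] at he
    exact ⟨e, he, by rw [hp e he, hb]⟩

theorem MemAgree.image_eq {τ σ : Comp Thread PVar DVar Adr Dom Func} (h : MemAgree τ σ) :
    τ.mem.image τ.valid = σ.mem.image σ.valid := image_eq_of_agree h.valid h.ptr

theorem MemAgree.validAdr_iff {τ σ : Comp Thread PVar DVar Adr Dom Func} (h : MemAgree τ σ)
    (b : Adr) : ValidAdr τ b ↔ ValidAdr σ b := by
  unfold ValidAdr
  rw [h.image_eq, h.valid]

theorem MemAgree.restrict_eq {τ σ : Comp Thread PVar DVar Adr Dom Func} (h : MemAgree τ σ) :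
    τ.mem.restrict τ.valid = σ.mem.restrict σ.valid := by
  have him := h.image_eq
  unfold Memory.restrict
  ext1
  · funext e
    by_cases he : e ∈ τ.valid
    · simpa only [if_pos he, if_pos (h.valid ▸ he)] using h.ptr e he
    · simp only [if_neg he, if_neg (h.valid ▸ he)]
  · funext e
    cases e with
    | var x => exact h.dat_var x
    | sel b =>
      by_cases hb : b ∈ τ.mem.image τ.valid
      · simpa only [if_pos hb, if_pos (him ▸ hb)] using h.dat_sel b hb
      · simp only [if_neg hb, if_neg (him ▸ hb)]

/-- Valid expressions are defined, so the set of valid expressions can be read off as the pointer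
domain of the restricted memory. -/
theorem memAgree_of_restrict_eq {τ σ : Comp Thread PVar DVar Adr Dom Func} (hτ : Inv τ)
    (hσ : Inv σ) (h : τ.mem.restrict τ.valid = σ.mem.restrict σ.valid) : MemAgree τ σ := by
  have hp : ∀ e, (τ.mem.restrict τ.valid).ptr e = (σ.mem.restrict σ.valid).ptr e := by simp [h]
  have hd : ∀ e, (τ.mem.restrict τ.valid).dat e = (σ.mem.restrict σ.valid).dat e := by simp [h]
  simp only [Memory.restrict] at hp
  have hv : τ.valid = σ.valid := by
    ext e
    have h1 := hp e
    have h2 := hτ.valid_def e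
    have h3 := hσ.valid_def e
    split_ifs at h1 <;> simp_all
  have hptr : ∀ e ∈ τ.valid, τ.mem.ptr e = σ.mem.ptr e := by
    intro e he
    have h1 := hp e
    rwa [if_pos he, if_pos (hv ▸ he)] at h1
  refine ⟨hv, hptr, fun x => hd (.var x), fun b hb => ?_⟩
  have h1 := hd (.sel b)
  simp only [Memory.restrict] at h1
  rwa [if_pos hb, if_pos (image_eq_of_agree hv hptr ▸ hb)] at h1

/-- Data selectors contribute no further address: the restriction keeps them only for addresses held
by valid pointers. -/
theorem Inv.mem_validAdrs {τ : Comp Thread PVar DVar Adr Dom Func} (hI : Inv τ) (b : Adr) :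
    b ∈ τ.validAdrs ↔ ValidAdr τ b := by
  unfold Comp.validAdrs Memory.adrs ValidAdr
  simp only [Memory.restrict, Set.mem_ofPred_eq]
  constructor
  · rintro (⟨e, he⟩ | h | h)
    · split at he
      · exact .inl ⟨e, ‹_›, he⟩
      · simp at he
    · split at h
      · exact .inr ‹_›
      · simp at h
    · split at h
      · exact .inl ‹_›
      · simp at h
  · rintro (⟨e, he, hb⟩ | h)
    · exact .inl ⟨e, by rw [if_pos he, hb]⟩
    · exact .inr (.inl (by rw [if_pos h]; exact hI.valid_def _ h))

/-- `σ` mimics `τ`, with the reuse of addresses confined to `a`. -/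
structure Rel (D : Program Thread PVar DVar Dom Func Loc) (O : Observer Func OLoc OVar) (a : Adr)
    (τ σ : Comp Thread PVar DVar Adr Dom Func) : Prop where
  ctrl : τ.ctrl D = σ.ctrl D
  mem : MemAgree τ σ
  var_iff : ∀ p, τ.mem.ptr (.var p) = some (.adr a) ↔ σ.mem.ptr (.var p) = some (.adr a)
  sel_iff : ∀ b ∈ τ.mem.image τ.valid,
    τ.mem.ptr (.sel b) = some (.adr a) ↔ σ.mem.ptr (.sel b) = some (.adr a)
  free_iff : a ∈ τ.fresh ∪ τ.freed ↔ a ∈ σ.fresh ∪ σ.freed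
  behavior : ∀ c, c = a ∨ ValidAdr τ c → O.behavior τ.history c ⊆ O.behavior σ.history c
  transfer : ∀ b ∈ τ.fresh ∪ τ.freed, Transfer O τ.history σ.history b

variable {D : Program Thread PVar DVar Dom Func Loc} {O : Observer Func OLoc OVar} {a : Adr}
  {τ σ : Comp Thread PVar DVar Adr Dom Func}

theorem Rel.similar (h : Rel D O a τ σ) : Similar D τ σ := ⟨h.ctrl, h.mem.restrict_eq⟩

theorem Rel.behaviorIncl (h : Rel D O a τ σ) (hI : Inv τ) : BehaviorIncl O τ σ :=
  fun c hc => h.behavior c (.inr ((hI.mem_validAdrs c).1 hc))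

theorem Rel.memEquiv (h : Rel D O a τ σ) : MemEquiv O a τ σ :=
  ⟨h.var_iff, h.sel_iff, h.free_iff, h.behavior a (.inl rfl)⟩

theorem Rel.freshIncl (E : SupportsElision Thread Adr Dom O) (h : Rel D O a τ σ) :
    FreshIncl O τ.history σ.history := E.freshIncl (h.behavior a (.inl rfl))

theorem rel_nil : Rel D O a (.nil : Comp Thread PVar DVar Adr Dom Func) .nil where
  ctrl := rfl
  mem := ⟨rfl, fun _ _ => rfl, fun _ => rfl, fun _ _ => rfl⟩
  var_iff _ := Iff.rfl
  sel_iff _ _ := Iff.rfl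
  free_iff := Iff.rfl
  behavior _ _ := subset_rfl
  transfer b _ := fun h hh hb => hh b (by simp [histFresh, Comp.history]) hb

theorem Rel.accessible_iff (h : Rel D O a τ σ) {e : PExp PVar Adr} (he : Accessible τ e) :
    τ.mem.ptr e = some (.adr a) ↔ σ.mem.ptr e = some (.adr a) := by
  cases e with
  | var p => exact h.var_iff p
  | sel b => exact h.sel_iff b he

/-- The relation is preserved by moving pointers in the same way in both computations. -/
theorem Rel.moves (h : Rel D O a τ σ) {τ' σ' : Comp Thread PVar DVar Adr Dom Func}
    {s : PExp PVar Adr → PExp PVar Adr} (hτ : Moves τ τ' s) (hσ : Moves σ σ' s)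
    (hs : SafeMove τ s) (hctrl : τ'.ctrl D = σ'.ctrl D)
    (hdv : ∀ x, τ'.mem.dat (.var x) = σ'.mem.dat (.var x))
    (hds : ∀ b ∈ τ.mem.image τ.valid, τ'.mem.dat (.sel b) = σ'.mem.dat (.sel b))
    (hb : ∀ c, c = a ∨ ValidAdr τ c → O.behavior τ'.history c ⊆ O.behavior σ'.history c)
    (ht : ∀ b ∈ τ.fresh ∪ τ.freed, Transfer O τ'.history σ'.history b) : Rel D O a τ' σ' where
  ctrl := hctrl
  mem :=
    { valid := by
        ext e
        rw [hτ.valid, hσ.valid, h.mem.valid]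
      ptr := by
        intro e he
        rw [hτ.ptr, hσ.ptr]
        exact h.mem.ptr _ ((hτ.valid e).1 he)
      dat_var := hdv
      dat_sel := fun b hb => hds b (hτ.image_subset hb) }
  var_iff p := by
    rw [hτ.ptr, hσ.ptr]
    rcases hs (.var p) with he | ⟨-, ha⟩
    · rw [he]; exact h.var_iff p
    · exact h.accessible_iff ha
  sel_iff b hb := by
    rw [hτ.ptr, hσ.ptr]
    rcases hs (.sel b) with he | ⟨-, ha⟩
    · rw [he]; exact h.sel_iff b (hτ.image_subset hb)
    · exact h.accessible_iff ha
  free_iff := by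
    rw [hτ.fresh, hτ.freed, hσ.fresh, hσ.freed]
    exact h.free_iff
  behavior c hc := hb c (hc.imp id (hτ.validAdr hs))
  transfer b hb := ht b (by rwa [hτ.fresh, hτ.freed] at hb)

variable [Infinite Adr]

theorem Rel.free_right (E : SupportsElision Thread Adr Dom O) (h : Rel D O a τ σ) (t : Thread)
    {b : Adr} (hs : τ.history ++ [.free b] ∈ O.spec) (hs' : σ.history ++ [.free b] ∈ O.spec) :
    Rel D O a (τ.snoc (freeAction t b)) (σ.snoc (freeAction t b)) where
  ctrl := h.ctrl
  mem :=
    { valid := by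
        ext e
        rw [mem_valid_free, mem_valid_free, ← h.mem.valid]
        refine and_congr_right fun he => ?_
        rw [h.mem.ptr e he]
      ptr := by
        intro e he
        rw [mem_valid_free] at he
        rw [ptr_free, ptr_free, if_neg he.2.2, if_neg he.2.2]
        exact h.mem.ptr e he.1
      dat_var := by
        intro x
        rw [dat_free, dat_free, if_neg (by simp), if_neg (by simp)]
        exact h.mem.dat_var x
      dat_sel := by
        intro c hc
        obtain ⟨hc, hcb⟩ := mem_image_free hc
        rw [dat_free, dat_free, if_neg (by simpa using hcb), if_neg (by simpa using hcb)]
        exact h.mem.dat_sel c hc }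
  var_iff p := by
    rw [ptr_free, ptr_free, if_neg (by simp), if_neg (by simp)]
    exact h.var_iff p
  sel_iff c hc := by
    obtain ⟨hc, hcb⟩ := mem_image_free hc
    rw [ptr_free, ptr_free, if_neg (by simpa using hcb), if_neg (by simpa using hcb)]
    exact h.sel_iff c hc
  free_iff := by
    have := h.free_iff
    simp only [Comp.fresh, Comp.freed, freeAction, Set.mem_union, Set.mem_sdiff,
      Set.mem_singleton_iff] at this ⊢
    tauto
  behavior c hc := by
    simp only [Comp.history, freeAction]
    by_cases hcb : c = b
    · subst hcb
      refine O.behavior_subset_append (h.behavior c (hc.imp_right fun h => ?_)) (by simp)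
      exact (validAdr_free h).1
    · rw [E.free _ b c (Ne.symm hcb) hs, E.free _ b c (Ne.symm hcb) hs']
      exact h.behavior c (hc.imp_right fun h => (validAdr_free h).1)
  transfer c hc := by
    have hinc := E.freshIncl_append_free hs'
    simp only [Comp.history, freeAction]
    refine .append_free E hs (E.freshIncl_trans (h.freshIncl E) hinc) fun hcb => ?_
    refine (h.transfer c ?_).mono E hinc
    simp only [Comp.fresh, Comp.freed, freeAction, Set.mem_union, Set.mem_sdiff,
      Set.mem_singleton_iff] at hc ⊢
    tauto

/-- `σ` might not be permitted to free `b`, as nothing is known about its behavior there. Dropping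
the free is harmless: it changes no part of the memory that `Rel` compares, and by elision support
it does not affect the behavior on other addresses. -/
theorem Rel.free_left (E : SupportsElision Thread Adr Dom O) (h : Rel D O a τ σ) (t : Thread)
    {b : Adr} (hs : τ.history ++ [.free b] ∈ O.spec) (hba : b ≠ a) (hb : ¬ ValidAdr τ b) :
    Rel D O a (τ.snoc (freeAction t b)) σ where
  ctrl := h.ctrl
  mem :=
    { valid := by
        ext e
        rw [mem_valid_free, ← h.mem.valid, and_iff_left_iff_imp]
        refine fun he => ⟨fun hp => hb (.inl ⟨e, he, hp⟩), ?_⟩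
        rintro rfl
        exact hb (.inr he)
      ptr := by
        intro e he
        rw [mem_valid_free] at he
        rw [ptr_free, if_neg he.2.2]
        exact h.mem.ptr e he.1
      dat_var := by
        intro x
        rw [dat_free, if_neg (by simp)]
        exact h.mem.dat_var x
      dat_sel := by
        intro c hc
        obtain ⟨hc, hcb⟩ := mem_image_free hc
        rw [dat_free, if_neg (by simpa using hcb)]
        exact h.mem.dat_sel c hc }
  var_iff p := by
    rw [ptr_free, if_neg (by simp)]
    exact h.var_iff p
  sel_iff c hc := by
    obtain ⟨hc, hcb⟩ := mem_image_free hc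
    rw [ptr_free, if_neg (by simpa using hcb)]
    exact h.sel_iff c hc
  free_iff := by
    rw [← h.free_iff]
    have := hba.symm
    simp only [Comp.fresh, Comp.freed, freeAction, Set.mem_union, Set.mem_sdiff,
      Set.mem_singleton_iff]
    tauto
  behavior c hc := by
    simp only [Comp.history, freeAction]
    have hcb : b ≠ c := by
      rcases hc with rfl | hc
      · exact hba
      · exact (validAdr_free hc).2.symm
    rw [E.free _ b c hcb hs]
    exact h.behavior c (hc.imp_right fun h => (validAdr_free h).1)
  transfer c hc := by
    simp only [Comp.history, freeAction]
    refine .append_free E hs (h.freshIncl E) fun hcb => h.transfer c ?_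
    simp only [Comp.fresh, Comp.freed, freeAction, Set.mem_union, Set.mem_sdiff,
      Set.mem_singleton_iff] at hc ⊢
    tauto

omit [Zero Dom] [Infinite Adr] in
theorem ctrl_prog_eq (h : τ.ctrl D = σ.ctrl D) (t : Thread) (c : Com PVar DVar Dom Func)
    (up up' : List (Upd PVar DVar Adr Dom)) :
    (τ.snoc ⟨t, .prog c, up⟩).ctrl D = (σ.snoc ⟨t, .prog c, up'⟩).ctrl D := by
  simp only [Comp.ctrl, h]

omit [Infinite Adr] in
-- The inclusion `hb` has to be supplied because the allocation makes `b` valid.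
theorem Rel.malloc (h : Rel D O a τ σ) (t : Thread) (p : PVar) {b : Adr} (d : Dom)
    (hb : O.behavior τ.history b ⊆ O.behavior σ.history b) :
    Rel D O a (τ.snoc (mallocAction t p b d)) (σ.snoc (mallocAction t p b d)) where
  ctrl := ctrl_prog_eq h.ctrl t _ _ _
  mem :=
    { valid := by
        ext e
        rw [mem_valid_malloc, mem_valid_malloc, h.mem.valid]
      ptr := by
        intro e he
        rw [mem_valid_malloc] at he
        rw [ptr_malloc, ptr_malloc]
        split
        · rfl
        · split
          · rfl
          · exact h.mem.ptr e (by tauto)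
      dat_var := by
        intro x
        rw [dat_malloc, dat_malloc, if_neg (by simp), if_neg (by simp)]
        exact h.mem.dat_var x
      dat_sel := by
        intro c hc
        rw [dat_malloc, dat_malloc]
        split
        · rfl
        · rename_i hne
          rcases mem_image_malloc hc with hc | rfl
          · exact h.mem.dat_sel c hc
          · exact absurd rfl hne }
  var_iff q := by
    rw [ptr_malloc, ptr_malloc]
    split
    · rfl
    · split
      · rfl
      · exact h.var_iff q
  sel_iff c hc := by
    rw [ptr_malloc, ptr_malloc]
    split
    · rfl
    · rename_i hne
      rcases mem_image_malloc hc with hc | rfl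
      · simpa using h.sel_iff c hc
      · exact absurd rfl hne
  free_iff := by
    have := h.free_iff
    simp only [fresh_malloc, freed_malloc, Set.mem_union, Set.mem_sdiff] at this ⊢
    tauto
  behavior c hc := by
    rw [history_malloc, history_malloc]
    rcases hc with hc | hc
    · exact h.behavior c (.inl hc)
    · rcases validAdr_malloc hc with hc | rfl
      · exact h.behavior c (.inr hc)
      · exact hb
  transfer c hc := by
    rw [history_malloc, history_malloc]
    refine h.transfer c ?_
    rw [fresh_malloc, freed_malloc] at hc
    exact hc.imp And.left And.left

open Classical in
-- The swap fixes `a` and all valid addresses, hence everything that `Rel` compares in memory; the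
-- replacement property keeps the behaviors on those addresses.
theorem Rel.perm_right (E : SupportsElision Thread Adr Dom O) (h : Rel D O a τ σ)
    {b c : Adr} (hba : b ≠ a) (hca : c ≠ a) (hb : ¬ ValidAdr τ b) (hc : ¬ ValidAdr τ c) :
    Rel D O a τ (σ.perm (Equiv.swap b c)) := by
  set π := Equiv.swap b c with hπ
  have hfix : ∀ {x}, ValidAdr τ x → π x = x := fun {x} hx =>
    Equiv.swap_apply_of_ne_of_ne (by rintro rfl; exact hb hx) (by rintro rfl; exact hc hx)
  have ha : π a = a := Equiv.swap_apply_of_ne_of_ne hba.symm hca.symm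
  have hm := mem_isPerm (π := π) σ
  have hsymm : ∀ x, π (π x) = x := Equiv.swap_apply_self b c
  have hval : ∀ {e : PExp PVar Adr}, e ∈ τ.valid → e.perm π = e := by
    intro e he
    cases e with
    | var p => rfl
    | sel x => rw [PExp.perm_sel, hfix (.inr he)]
  have hinv : ∀ e : PExp PVar Adr, (e.perm π).perm π = e := by
    rintro (p | x) <;> simp [hsymm]
  have hadr : ∀ v : Option (PVal Adr), v.map (PVal.perm π) = some (.adr a) ↔ v = some (.adr a) := by
    intro v
    conv_lhs => rw [← ha]
    exact map_perm_eq_some_adr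
  have hfr := mem_fresh_perm (π := π) σ a
  have hfd := mem_freed_perm (π := π) σ a
  rw [ha] at hfr hfd
  refine ⟨by rw [ctrl_perm, h.ctrl], ⟨?_, ?_, ?_, ?_⟩, ?_, ?_, ?_, ?_, ?_⟩
  · ext e
    constructor
    · intro he
      rw [← hval he, mem_valid_perm, ← h.mem.valid]
      exact he
    · intro he
      rw [← hinv e, mem_valid_perm, ← h.mem.valid] at he
      have := hval he
      rw [hinv] at this
      rw [this]
      exact he
  · intro e he
    have := hm.ptr e
    rw [hval he] at this
    rw [this, ← h.mem.ptr e he]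
    rcases hv : τ.mem.ptr e with _ | _ | x
    · rfl
    · rfl
    · simp [hfix (.inl ⟨e, he, hv⟩)]
  · intro x
    rw [hm.dat_var, h.mem.dat_var]
  · intro x hx
    have := hm.dat (.sel x)
    rw [DExp.perm_sel, hfix (.inl hx)] at this
    rw [this, h.mem.dat_sel x hx]
  · intro p
    rw [hm.ptr_var, hadr, h.var_iff]
  · intro x hx
    have := hm.ptr_sel x
    rw [hfix (.inl hx)] at this
    rw [this, hadr, h.sel_iff x hx]
  · rw [h.free_iff, Set.mem_union, Set.mem_union, hfr, hfd]
  · intro x hx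
    have hxb : b ≠ x := by
      rintro rfl
      exact hx.elim hba hb
    have hxc : c ≠ x := by
      rintro rfl
      exact hx.elim hca hc
    rw [history_perm, E.behavior_map_perm_swap _ hxb hxc]
    exact h.behavior x hx
  · intro x hx
    rw [history_perm]
    exact (h.transfer x hx).mono E (E.freshIncl_map_perm_swap _ b c)

end Relation

/-! ### Mimicking a computation step by step -/

section Simulation

theorem getElem?_forall₂ {α β : Type*} {R : α → β → Prop} {l : List α} {l' : List β}
    (h : List.Forall₂ R l l') {i : ℕ} {x : α} {y : β} (hx : l[i]? = some x)
    (hy : l'[i]? = some y) : R x y := by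
  induction h generalizing i with
  | nil => simp at hx
  | cons hr _ ih =>
    cases i with
    | zero =>
      simp only [List.getElem?_cons_zero, Option.some.injEq] at hx hy
      rwa [← hx, ← hy]
    | succ i => exact ih (by simpa using hx) (by simpa using hy)

theorem forall₂_filterMap {α β : Type*} {f : α → Option β} {l : List α}
    (h : ∀ x ∈ l, ∃ y, f x = some y) :
    List.Forall₂ (fun x y => f x = some y) l (l.filterMap f) := by
  induction l with
  | nil => exact .nil
  | cons x l ih =>
    obtain ⟨y, hy⟩ := h x (by simp)
    rw [List.filterMap_cons_some hy]
    exact .cons hy (ih fun z hz => h z (by simp [hz]))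

variable {Thread PVar DVar Adr Dom Func Loc OLoc OVar : Type*} [Zero Dom] [LT Dom]
  {D : Program Thread PVar DVar Dom Func Loc} {O : Observer Func OLoc OVar} {a : Adr}
  {τ σ : Comp Thread PVar DVar Adr Dom Func}

omit [Zero Dom] [LT Dom] in
theorem forall₂_adrOf {m : Memory PVar DVar Adr Dom} {ps : List PVar}
    (h : ∀ p ∈ ps, ∃ a, m.ptr (.var p) = some (.adr a)) :
    List.Forall₂ (fun p a => m.ptr (.var p) = some (.adr a)) ps (ps.filterMap m.adrOf) := by
  have := forall₂_filterMap (f := m.adrOf) (l := ps)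
    (by simpa only [Memory.adrOf_eq_some] using h)
  simpa only [Memory.adrOf_eq_some] using this

/-- A call which is not racy allows at least as much as a call with other addresses in place of
the invalid arguments. -/
theorem PointerRaceFree.call_behavior_subset (hrace : PointerRaceFree Adr D O) {t : Thread}
    {f : Func} {ps : List PVar} {xs : List DVar}
    (hsem : Sem D O {a} (σ.snoc ⟨t, .prog (.enter f ps xs), []⟩))
    (hτ : ∀ p ∈ ps, ∃ a, τ.mem.ptr (.var p) = some (.adr a))
    (hσ : ∀ p ∈ ps, ∃ a, σ.mem.ptr (.var p) = some (.adr a))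
    (hxs : ∀ x ∈ xs, ∃ d, σ.mem.dat (.var x) = some d) {c : Adr} {g : Adr → Adr}
    (hg : ∀ p ∈ ps, ∀ x y, σ.mem.ptr (.var p) = some (.adr x) →
      τ.mem.ptr (.var p) = some (.adr y) → x = c ∨ PExp.var p ∈ σ.valid → x = g y) :
    O.behavior (σ.history ++ [.call f t ((ps.filterMap τ.mem.adrOf).map g)
        (xs.filterMap fun x => σ.mem.dat (.var x))]) c ⊆
      O.behavior (σ.history ++ [.call f t (ps.filterMap σ.mem.adrOf)
        (xs.filterMap fun x => σ.mem.dat (.var x))]) c := by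
  have h1 := forall₂_adrOf hτ
  have h2 := forall₂_adrOf hσ
  by_contra hn
  -- Otherwise the call of `σ` would be racy, with the renamed arguments of `τ` as the alternative
  -- addresses.
  refine hrace a σ _ hsem (.inr ⟨f, ps, xs, _, _, rfl, h2, forall₂_filterMap hxs, c, _, ?_, ?_, hn⟩)
  · rw [List.length_map, ← h1.length_eq, h2.length_eq]
  · intro i p x z hp hx hz hor
    rw [List.getElem?_map, Option.map_eq_some_iff] at hz
    obtain ⟨y, hy, rfl⟩ := hz
    exact hg p (List.mem_of_getElem? hp) x y (getElem?_forall₂ h2 hp hx) (getElem?_forall₂ h1 hp hy)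
      hor

omit [LT Dom] in
-- A variable with value `seg` is always valid, so if it were `seg` in `σ` it would be `seg` in `τ`
-- too.
theorem Rel.exists_adr (h : Rel D O a τ σ) (hσ : Inv σ) {p : PVar} {b : Adr}
    (hp : τ.mem.ptr (.var p) = some (.adr b)) : ∃ b', σ.mem.ptr (.var p) = some (.adr b') := by
  rcases hv : σ.mem.ptr (.var p) with _ | _ | b'
  · exact absurd hv (hσ.var_def p)
  · have hpv := hσ.seg_valid _ hv
    rw [← h.mem.valid] at hpv
    rw [← h.mem.ptr _ hpv, hp] at hv
    simp at hv
  · exact ⟨b', rfl⟩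

/-- Dereferenced variables are valid and all data variables agree, so both computations read the
same data. Invalid pointer values may differ, but only assertions depend on them for being enabled,
whence `ha`. -/
theorem Rel.exists_enabled (h : Rel D O a τ σ) (hσ : Inv σ) {X Y : Set Adr}
    {c : Com PVar DVar Dom Func} {up : List (Upd PVar DVar Adr Dom)} (hc : Enabled τ X c up)
    (hs : ∀ p ∈ c.derefs, PExp.var p ∈ τ.valid) (hm : ∀ p, c ≠ .malloc p)
    (ha : ∀ d, c = .assert d → d.Holds σ.mem) (t : Thread) :
    ∃ up', Enabled σ Y c up' ∧
      (∀ x, (τ.snoc ⟨t, .prog c, up⟩).mem.dat (.var x) =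
        (σ.snoc ⟨t, .prog c, up'⟩).mem.dat (.var x)) ∧
      ∀ b ∈ τ.mem.image τ.valid, (τ.snoc ⟨t, .prog c, up⟩).mem.dat (.sel b) =
        (σ.snoc ⟨t, .prog c, up'⟩).mem.dat (.sel b) := by
  have hx := h.mem.dat_var
  have hsel := h.mem.dat_sel
  have hp : ∀ {p b}, p ∈ c.derefs → τ.mem.ptr (.var p) = some (.adr b) →
      σ.mem.ptr (.var p) = some (.adr b) := by
    intro p b hpd hp
    rw [← h.mem.ptr _ (hs p hpd), hp]
  cases hc with
  | malloc p => exact absurd rfl (hm p)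
  | enter f ps xs hps hxs =>
    refine ⟨[], .enter f ps xs (fun p hp => ?_) (by simpa only [hx] using hxs), hx, hsel⟩
    obtain ⟨b, hb⟩ := hps p hp
    exact h.exists_adr hσ hb
  | exit => exact ⟨[], .exit, hx, hsel⟩
  | assign p q => exact ⟨_, .assign p q, hx, hsel⟩
  | store p q b hb => exact ⟨_, .store p q b (hp (p := p) rfl hb), hx, hsel⟩
  | load p q b hb => exact ⟨_, .load p q b (hp (p := q) rfl hb), hx, hsel⟩
  | op x f ys ds hys =>
    refine ⟨_, .op x f ys ds (by simpa only [hx] using hys), fun y => ?_, fun b hb => ?_⟩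
    · simp only [Comp.mem, Memory.apply, Memory.set, List.foldl, Function.update_apply, hx]
    · simp only [Comp.mem, Memory.apply, Memory.set, List.foldl, Function.update_apply, hsel b hb]
  | storeData p y b hb =>
    refine ⟨_, .storeData p y b (hp (p := p) rfl hb), fun y => ?_, fun b hb => ?_⟩
    · simp only [Comp.mem, Memory.apply, Memory.set, List.foldl, Function.update_apply, hx]
    · simp only [Comp.mem, Memory.apply, Memory.set, List.foldl, Function.update_apply, hx,
        hsel b hb]
  | loadData x q b hb =>
    have hbi := hsel b ⟨.var q, hs q rfl, hb⟩
    refine ⟨_, .loadData x q b (hp (p := q) rfl hb), fun y => ?_, fun b' hb' => ?_⟩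
    · simp only [Comp.mem, Memory.apply, Memory.set, List.foldl, Function.update_apply, hx, hbi]
    · simp only [Comp.mem, Memory.apply, Memory.set, List.foldl, Function.update_apply, hbi,
        hsel b' hb']
  | assert d hd => exact ⟨[], .assert d (ha d rfl), hx, hsel⟩

/-- Agreement on the dereferenced variable alone lets the access happen in another computation. This
is used before the variable is known to be valid. -/
theorem Enabled.exists_deref {X : Set Adr} {c : Com PVar DVar Dom Func}
    {up : List (Upd PVar DVar Adr Dom)} (hc : Enabled τ X c up) {p : PVar} (hp : p ∈ c.derefs) :
    ∃ b, τ.mem.ptr (.var p) = some (.adr b) ∧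
      ∀ (σ : Comp Thread PVar DVar Adr Dom Func) (Y : Set Adr),
        σ.mem.ptr (.var p) = some (.adr b) → ∃ up', Enabled σ Y c up' := by
  cases hc with
  | store _ q b hb =>
    obtain rfl : p = _ := hp
    exact ⟨b, hb, fun σ Y h => ⟨_, .store p q b h⟩⟩
  | load p' _ b hb =>
    obtain rfl : p = _ := hp
    exact ⟨b, hb, fun σ Y h => ⟨_, .load p' p b h⟩⟩
  | storeData _ y b hb =>
    obtain rfl : p = _ := hp
    exact ⟨b, hb, fun σ Y h => ⟨_, .storeData p y b h⟩⟩
  | loadData x _ b hb =>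
    obtain rfl : p = _ := hp
    exact ⟨b, hb, fun σ Y h => ⟨_, .loadData x p b h⟩⟩
  | _ => exact absurd hp (by simp [Com.derefs])

/-- Some address makes every computation which is related with respect to it satisfy a given
condition. -/
theorem Cond.exists_holds [Nonempty Adr] (hI : Inv τ) {c : Cond PVar DVar} (hc : c.Holds τ.mem) :
    ∃ b, ∀ σ, Rel D O b τ σ → c.Holds σ.mem := by
  cases c with
  | peq p q =>
    have hc : τ.mem.ptr (.var p) = τ.mem.ptr (.var q) := hc
    rcases hv : τ.mem.ptr (.var p) with _ | _ | b
    · exact absurd hv (hI.var_def p)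
    -- Both variables are `seg`, hence valid, so any address will do.
    · refine ⟨Classical.arbitrary Adr, fun σ h => ?_⟩
      have hq := hv
      rw [hc] at hq
      simp only [Cond.Holds]
      rw [← h.mem.ptr _ (hI.seg_valid _ hv), ← h.mem.ptr _ (hI.seg_valid _ hq), hc]
    · refine ⟨b, fun σ h => ?_⟩
      simp only [Cond.Holds]
      rw [(h.var_iff p).1 hv, (h.var_iff q).1 (hc ▸ hv)]
  | pne p q =>
    have hc : τ.mem.ptr (.var p) ≠ τ.mem.ptr (.var q) := hc
    rcases hv : τ.mem.ptr (.var p) with _ | _ | b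
    · exact absurd hv (hI.var_def p)
    · rcases hw : τ.mem.ptr (.var q) with _ | _ | b
      · exact absurd hw (hI.var_def q)
      · exact absurd (hv.trans hw.symm) hc
      -- For an inequality, `b` is an address held by one of the two variables: if `σ` identified
      -- them, both would hold `b` in `σ` and hence in `τ`.
      · refine ⟨b, fun σ h heq => ?_⟩
        rw [(h.var_iff q).1 hw] at heq
        exact hc (((h.var_iff p).2 heq).trans hw.symm)
    · refine ⟨b, fun σ h heq => ?_⟩
      rw [(h.var_iff p).1 hv] at heq
      exact hc (hv.trans ((h.var_iff q).2 heq.symm).symm)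
  | _ =>
    refine ⟨Classical.arbitrary Adr, fun σ h => ?_⟩
    simpa only [Cond.Holds, h.mem.dat_var] using hc

variable [Infinite Adr]

/-- A command other than an allocation can be mimicked. -/
theorem Rel.prog (hrace : PointerRaceFree Adr D O) (E : SupportsElision Thread Adr Dom O)
    (h : Rel D O a τ σ) (hτ : Inv τ) (hσ : Sem D O {a} σ) {t : Thread}
    {c : Com PVar DVar Dom Func} {up : List (Upd PVar DVar Adr Dom)} {X : Set Adr}
    (hctrl : D.next t (τ.ctrl D t) c ≠ none) (hc : Enabled τ X c up)
    (hs : ∀ p ∈ c.derefs, PExp.var p ∈ τ.valid) (hm : ∀ p, c ≠ .malloc p)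
    (ha : ∀ d, c = .assert d → d.Holds σ.mem) :
    ∃ up', Sem D O {a} (σ.snoc ⟨t, .prog c, up'⟩) ∧
      Rel D O a (τ.snoc ⟨t, .prog c, up⟩) (σ.snoc ⟨t, .prog c, up'⟩) := by
  classical
  obtain ⟨hIσ, hJσ⟩ := hσ.inv hrace
  obtain ⟨up', hc', hdv, hds⟩ := h.exists_enabled (Y := {a}) hIσ hc hs hm ha t
  rw [h.ctrl] at hctrl
  have hsem := Sem.prog t c up' hσ hctrl hc'
  obtain ⟨s, hmτ, hmσ, hsm⟩ := exists_common_moves t h.mem.valid h.mem.ptr hc hc' hs hm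
  refine ⟨up', hsem, h.moves hmτ hmσ hsm (ctrl_prog_eq h.ctrl t c _ _) hdv hds ?_ ?_⟩
  · intro b hb
    have hbeh := h.behavior b hb
    cases hc with
    | enter f ps xs hps hxs =>
      cases hc' with | enter _ _ _ hps' hxs' =>
      simp only [Comp.history, h.mem.dat_var]
      -- First append the event of `τ` on both sides, then exchange it for the event of `σ` by race
      -- freedom.
      refine (O.behavior_subset_append hbeh (by simp)).trans ?_
      have := hrace.call_behavior_subset (c := b) (g := id) hsem hps hps' hxs' ?_
      · simpa using this
      · intro p _ x y hx hy hor
        by_cases hpv : PExp.var p ∈ σ.valid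
        · rw [← h.mem.valid] at hpv
          rw [h.mem.ptr _ hpv, hx] at hy
          simpa using hy
        -- An invalid argument of `σ` that equals the observed address: it is either `a`, which both
        -- computations see in the same variables, or a valid address, which no invalid pointer of
        -- `σ` can hold.
        · obtain rfl : x = b := by tauto
          by_cases hxa : x = a
          · subst hxa
            rw [(h.var_iff p).2 hx] at hy
            simpa using hy
          · have hxv := (h.mem.validAdr_iff x).1 (hb.resolve_left hxa)
            exact absurd hxv (hJσ _ x hx hpv hxa)
    | exit => exact O.behavior_subset_append hbeh (by simp)
    | _ => exact hbeh
  · intro b hb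
    have htr := h.transfer b hb
    cases hc with
    | enter f ps xs hps hxs =>
      cases hc' with | enter _ _ _ hps' hxs' =>
      simp only [Comp.history, h.mem.dat_var]
      refine htr.append E (by simp) fun d hd _ => ?_
      refine hrace.call_behavior_subset (c := d) hsem hps hps' hxs' ?_
      intro p hp x y hx hy hor
      -- The address `d` is new to the call of `σ`, so only the valid arguments have to agree.
      have hxd : x ≠ d := by
        rintro rfl
        rw [histFresh_append] at hd
        refine mem_histFresh_singleton.1 hd.2 (List.mem_filterMap.2 ⟨p, hp, ?_⟩)
        exact Memory.adrOf_eq_some.2 hx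
      have hpv := hor.resolve_left hxd
      rw [← h.mem.valid] at hpv
      rw [← h.mem.ptr _ hpv, hy] at hx
      obtain rfl : y = x := by simpa using hx
      -- Valid arguments survive the swap: they are not `d`, and they are not `b`, which `τ` could
      -- allocate and which is thus not valid.
      refine (Equiv.swap_apply_of_ne_of_ne ?_ hxd).symm
      rintro rfl
      exact hτ.not_validAdr y hb (.inl ⟨_, hpv, hy⟩)
    | exit => exact htr.append E (by simp) fun d _ _ => subset_rfl
    | _ => exact htr

/-- An allocation can be mimicked, possibly after renaming addresses. -/
theorem Rel.exists_malloc (hrace : PointerRaceFree Adr D O) (E : SupportsElision Thread Adr Dom O)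
    (h : Rel D O a τ σ) (hτ : Inv τ) (hσ : Sem D O {a} σ) {t : Thread} {p : PVar} {b : Adr}
    {d : Dom} (hctrl : D.next t (τ.ctrl D t) (.malloc p) ≠ none) (hb : b ∈ τ.fresh ∪ τ.freed) :
    ∃ σ', Sem D O {a} σ' ∧ Rel D O a (τ.snoc (mallocAction t p b d)) σ' := by
  classical
  by_cases hba : b = a
  · subst hba
    refine ⟨_, .prog t _ _ hσ (h.ctrl ▸ hctrl) (.malloc p b d ?_),
      h.malloc t p d (h.behavior b (.inl rfl))⟩
    exact (h.free_iff.1 hb).imp id fun hf => ⟨hf, rfl⟩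
  -- `c` is fresh in `σ` and hence not valid in `τ`. It must differ from `a` so that the swap fixes
  -- `a`.
  · obtain ⟨c, hc⟩ := ((finite_compl_fresh hσ).union (Set.finite_singleton a)).exists_notMem
    simp only [Set.mem_union, Set.mem_compl_iff, Set.mem_singleton_iff, not_or, not_not] at hc
    have hcv : ¬ ValidAdr τ c := by
      rw [h.mem.validAdr_iff]
      exact (hσ.inv hrace).1.not_validAdr c (.inl hc.1)
    have h' := h.perm_right E hba hc.2 (hτ.not_validAdr b hb) hcv
    have hσ' : Sem D O {a} (σ.perm (Equiv.swap b c)) := by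
      refine hσ.perm fun x hx => ?_
      obtain rfl : x = a := hx
      exact Equiv.swap_apply_of_ne_of_ne (Ne.symm hba) (Ne.symm hc.2)
    have hbf : b ∈ (σ.perm (Equiv.swap b c)).fresh := by
      have := (mem_fresh_perm (π := Equiv.swap b c) σ c).2 hc.1
      rwa [Equiv.swap_apply_right] at this
    refine ⟨_, .prog t _ _ hσ' (h'.ctrl ▸ hctrl) (.malloc p b d (.inl hbf)), h'.malloc t p d ?_⟩
    -- After the swap `b` is new to the history of the renamed `σ`, so `Transfer` applies to that
    -- history itself.
    exact h'.transfer b hb _ (fun _ _ _ => subset_rfl) ((hσ'.inv hrace).1.histFresh b hbf)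

/-- An assertion can be mimicked in the absence of harmful ABAs. -/
theorem Rel.exists_assert (hrace : PointerRaceFree Adr D O) (haba : HarmfulABAFree Adr D O)
    (E : SupportsElision Thread Adr Dom O) (hτ : Inv τ)
    (ih : ∀ a, ∃ σ, Sem D O {a} σ ∧ Rel D O a τ σ) {t : Thread} {c : Cond PVar DVar}
    (hctrl : D.next t (τ.ctrl D t) (.assert c) ≠ none) (hc : c.Holds τ.mem) (a : Adr) :
    ∃ σ', Sem D O {a} σ' ∧ Rel D O a (τ.snoc ⟨t, .prog (.assert c), []⟩) σ' := by
  obtain ⟨b, hb⟩ := Cond.exists_holds (D := D) (O := O) hτ hc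
  obtain ⟨σb, hσb, hrb⟩ := ih b
  obtain ⟨σa, hσa, hra⟩ := ih a
  have hen : Enabled τ Set.univ (.assert c : Com PVar DVar Dom Func) [] := .assert c hc
  obtain ⟨up', hsem, hrel⟩ := hrb.prog hrace E hτ hσb hctrl hen (by simp [Com.derefs]) (by simp)
    (by rintro d ⟨⟩; exact hb σb hrb)
  have hIτ := hτ.prog t hen (by simp [Com.derefs])
  obtain ⟨s, hmv, -, -⟩ :=
    exists_common_moves t rfl (fun _ _ => rfl) hen hen (by simp [Com.derefs]) (by simp)
  have hsim : Similar D σb σa :=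
    ⟨hrb.ctrl.symm.trans hra.ctrl, hrb.similar.2.symm.trans hra.similar.2⟩
  -- `σ'` inherits control, valid memory and the behavior on valid addresses from `σb` after the
  -- assertion. Everything that concerns `a` comes from `σa`, and carries over because an assertion
  -- changes neither memory nor history.
  obtain ⟨σ', hσ', hsim', hme, hbi⟩ := haba b a σb _ σa hsem hσa hsim ⟨c, rfl⟩
  have hinc : O.behavior σa.history a ⊆ O.behavior σ'.history a := hme.2.2.2
  have himg := hmv.image_subset
  refine ⟨σ', hσ', hrel.ctrl.trans hsim'.1, ?_, ?_, ?_, ?_, ?_, ?_⟩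
  · exact memAgree_of_restrict_eq hIτ (hσ'.inv hrace).1 (hrel.similar.2.trans hsim'.2)
  · exact fun p => (hra.var_iff p).trans (hme.1 p)
  · intro x hx
    exact (hra.sel_iff x (himg hx)).trans (hme.2.1 x (hra.mem.image_eq ▸ himg hx))
  · exact hra.free_iff.trans hme.2.2.1
  · rintro x (rfl | hx)
    · exact (hra.behavior x (.inl rfl)).trans hinc
    · refine (hrel.behavior x (.inr hx)).trans (hbi x ?_)
      rw [(hsem.inv hrace).1.mem_validAdrs]
      exact (hrel.mem.validAdr_iff x).1 hx
  -- The inclusion at `a` alone already compares `σa` with `σ'` on all new addresses.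
  · exact fun x hx => (hra.transfer x hx).mono E (E.freshIncl hinc)

theorem exists_rel (hrace : PointerRaceFree Adr D O) (haba : HarmfulABAFree Adr D O)
    (E : SupportsElision Thread Adr Dom O) (hτ : Sem D O Set.univ τ) :
    Inv τ ∧ ∀ a, ∃ σ, Sem D O {a} σ ∧ Rel D O a τ σ := by
  induction hτ with
  | nil => exact ⟨inv_nil, fun a => ⟨.nil, .nil, rel_nil⟩⟩
  | @prog τ t c up _ hctrl hc ih =>
    obtain ⟨hI, ih⟩ := ih
    have hs : ∀ p ∈ c.derefs, PExp.var p ∈ τ.valid := by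
      intro p hp
      -- Race freedom is assumed only for computations that reuse one address, so it is applied to
      -- the `σ` for the very address that `p` holds.
      obtain ⟨b, hb, hen⟩ := hc.exists_deref hp
      obtain ⟨σ, hσ, hr⟩ := ih b
      obtain ⟨up', hc'⟩ := hen σ {b} ((hr.var_iff p).1 hb)
      rw [hr.mem.valid]
      exact hrace.safe (.prog t c up' hσ (hr.ctrl ▸ hctrl) hc') p hp
    refine ⟨hI.prog t hc hs, fun a => ?_⟩
    by_cases hm : ∃ p, c = .malloc p
    · obtain ⟨p, rfl⟩ := hm
      obtain ⟨σ, hσ, hr⟩ := ih a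
      cases hc with | malloc _ b d hb =>
      exact hr.exists_malloc hrace E hI hσ hctrl (hb.imp id And.left)
    by_cases hcond : ∃ d, c = .assert d
    · obtain ⟨d, rfl⟩ := hcond
      cases hc with | assert _ hd =>
      exact Rel.exists_assert hrace haba E hI ih hctrl hd a
    push Not at hm hcond
    obtain ⟨σ, hσ, hr⟩ := ih a
    obtain ⟨up', hsem, hrel⟩ := hr.prog hrace E hI hσ hctrl hc hs hm
      fun d hd => absurd hd (hcond d)
    exact ⟨_, hsem, hrel⟩
  | @free τ t b _ hb ih =>
    obtain ⟨hI, ih⟩ := ih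
    refine ⟨hI.free t b, fun a => ?_⟩
    obtain ⟨σ, hσ, hr⟩ := ih a
    -- Exactly for these addresses `Rel` includes the behavior of `τ` in that of `σ`, and the free
    -- is itself a continuation counted there.
    by_cases hba : b = a ∨ ValidAdr τ b
    · have hb' := O.free_mem_spec_of_behavior_subset (hr.behavior b hba) hb
      exact ⟨_, .free t b hσ hb', hr.free_right E t hb hb'⟩
    · rw [not_or] at hba
      exact ⟨σ, hσ, hr.free_left E t hb hba.1 hba.2⟩

end Simulation

end SMR

theorem mainTheorem2 {Thread PVar DVar Adr Dom Func Loc OLoc OVar : Type*}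
    [Infinite Adr] [Zero Dom] [LT Dom]
    (D : SMR.Program Thread PVar DVar Dom Func Loc) (O : SMR.Observer Func OLoc OVar)
    (hrace : SMR.PointerRaceFree Adr D O) (haba : SMR.HarmfulABAFree Adr D O)
    (helision : SMR.SupportsElision Thread Adr Dom O)
    (τ : SMR.Comp Thread PVar DVar Adr Dom Func) (hτ : SMR.Sem D O Set.univ τ) (a : Adr) :
    ∃ σ : SMR.Comp Thread PVar DVar Adr Dom Func, SMR.Sem D O {a} σ ∧
      SMR.Similar D τ σ ∧ SMR.BehaviorIncl O τ σ ∧ SMR.MemEquiv O a τ σ := by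
  obtain ⟨hI, h⟩ := SMR.exists_rel hrace haba helision hτ
  obtain ⟨σ, hσ, hr⟩ := h a
  exact ⟨σ, hσ, hr.similar, hr.behaviorIncl hI, hr.memEquiv⟩
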